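/- Let $n\ge 0$ and let $M_n(\mathbb{C})\times M_n(\mathbb{C})$ carry the Zariski topology. Put $$\mathscr{N}_n=\{(A,B)\in M_n(\mathbb{C})\times M_n(\mathbb{C}) \mid AB+BA=0,\ A \text{ nilpotent}\}.$$ For a partition $\lambda=(\lambda_1\ge\lambda_2\ge\cdots)$ of $n$, let $J_\lambda(0)$ be the block diagonal matrix whose diagonal blocks are the nilpotent Jordan blocks of sizes $\lambda_1,\lambda_2,\dots$, and let $\mathscr{N}_\lambda$ be the Zariski closure of the union of the $GL_n(\mathbb{C})$-orbits, under the action $g\cdot(A,B)=(gAg^{-1},gBg^{-1})$, of all pairs $(J_\lambda(0),B)\in\mathscr{N}_n$, that is $$\mathscr{N}_\lambda=\overline{\{(gJ_\lambda(0)g^{-1},\,gBg^{-1}) \mid g\in GL_n(\mathbb{C}),\ B\in M_n(\mathbb{C}),\ J_\lambda(0)B+BJ_\lambda(0)=0\}}.$$ Then $\mathscr{N}_n$ is Zariski closed, its irreducible components are exactly the sets $\mathscr{N}_\lambda$, where $\lambda$ runs over the partitions of $n$, and $\mathscr{N}_\lambda\ne\mathscr{N}_\mu$ for $\lambda\neq\mu$.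 Moreover, $\dim\mathscr{N}_\lambda=n^2$ for every partition $\lambda$ of $n$. -/

import Mathlib

/-- A pair `(A, B)` of complex `n × n` matrices, i.e. a point of `M_n(ℂ) × M_n(ℂ)`.
It is a separate type so that the only topology on it is the Zariski topology below. -/
@[ext]
structure MatPair (n : ℕ) where
  A : Matrix (Fin n) (Fin n) ℂ
  B : Matrix (Fin n) (Fin n) ℂ

namespace MatPair

/-- The `2 n²` coordinate functions on `M_n(ℂ) × M_n(ℂ)`: the entries of `A`, then those of `B`. -/
def coords {n : ℕ} (P : MatPair n) : (Fin n × Fin n) ⊕ (Fin n × Fin n) → ℂ :=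
  Sum.elim (fun ij => P.A ij.1 ij.2) (fun ij => P.B ij.1 ij.2)

/-- The common zeros in `M_n(ℂ) × M_n(ℂ)` of a set of polynomials in the `2 n²` matrix entries. -/
def zeroLocus {n : ℕ} (S : Set (MvPolynomial ((Fin n × Fin n) ⊕ (Fin n × Fin n)) ℂ)) :
    Set (MatPair n) :=
  {P | ∀ f ∈ S, MvPolynomial.eval P.coords f = 0}

/-- The Zariski topology on `M_n(ℂ) × M_n(ℂ)`: the closed sets are the zero loci of sets of
polynomials. -/
instance zariskiTopology (n : ℕ) : TopologicalSpace (MatPair n) :=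
  TopologicalSpace.ofClosed {Z | ∃ S, Z = zeroLocus S}
    ⟨{1}, by ext P; simp [zeroLocus]⟩
    (by
      intro 𝒵 h𝒵
      refine ⟨{f | ∃ S, zeroLocus S ∈ 𝒵 ∧ f ∈ S}, ?_⟩
      ext P
      constructor
      · rintro hP f ⟨S, hS, hf⟩
        exact hP _ hS f hf
      · intro hP Z hZ
        obtain ⟨S, rfl⟩ := h𝒵 hZ
        exact fun f hf => hP f ⟨S, hZ, hf⟩)
    (by
      rintro _ ⟨S, rfl⟩ _ ⟨T, rfl⟩
      refine ⟨{h | ∃ f ∈ S, ∃ g ∈ T, h = f * g}, ?_⟩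
      ext P
      constructor
      · rintro (hP | hP) _ ⟨f, hf, g, hg, rfl⟩
        · simp [hP f hf]
        · simp [hP g hg]
      · intro hP
        by_contra hcon
        simp only [Set.mem_union, not_or] at hcon
        obtain ⟨h1, h2⟩ := hcon
        simp only [zeroLocus, Set.mem_ofPred_eq, not_forall] at h1 h2
        obtain ⟨f, hf, hf0⟩ := h1
        obtain ⟨g, hg, hg0⟩ := h2
        have h := hP (f * g) ⟨f, hf, g, hg, rfl⟩
        rw [map_mul] at h
        exact (mul_ne_zero hf0 hg0) h)

/-- The Zariski closed sets are exactly the zero loci of sets of polynomials. -/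
theorem isClosed_iff {n : ℕ} (Z : Set (MatPair n)) :
    IsClosed Z ↔ ∃ S, Z = zeroLocus S := by
  rw [← isOpen_compl_iff]
  change Zᶜᶜ ∈ {Z | ∃ S, Z = zeroLocus S} ↔ _
  rw [compl_compl]
  rfl

/-- Simultaneous conjugation `g • (A, B) = (g A g⁻¹, g B g⁻¹)` by `g ∈ GL_n(ℂ)`. -/
def conj {n : ℕ} (g : GL (Fin n) ℂ) (P : MatPair n) : MatPair n where
  A := (g : Matrix (Fin n) (Fin n) ℂ) * P.A * ((g⁻¹ : GL (Fin n) ℂ) : Matrix (Fin n) (Fin n) ℂ)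
  B := (g : Matrix (Fin n) (Fin n) ℂ) * P.B * ((g⁻¹ : GL (Fin n) ℂ) : Matrix (Fin n) (Fin n) ℂ)

end MatPair

/-- The semi-nilpotent anti-commuting variety `N_n`. -/
def semiNilpotentVariety (n : ℕ) : Set (MatPair n) :=
  {P | P.A * P.B + P.B * P.A = 0 ∧ IsNilpotent P.A}

/-- The `m × m` Jordan block with eigenvalue `α` (ones on the superdiagonal). -/
def jordanBlock (m : ℕ) (α : ℂ) : Matrix (Fin m) (Fin m) ℂ :=
  Matrix.of fun i j => if i = j then α else if (i : ℕ) + 1 = j then 1 else 0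

/-- The parts `λ₁ ≥ λ₂ ≥ …` of a partition of `n`, in weakly decreasing order. -/
def Nat.Partition.toComposition {n : ℕ} (l : n.Partition) : Composition n where
  blocks := l.parts.sort (· ≥ ·)
  blocks_pos := fun hi => l.parts_pos ((Multiset.mem_sort _).1 hi)
  blocks_sum := by
    rw [← Multiset.sum_coe, Multiset.sort_eq, l.parts_sum]

/-- The Jordan normal form `J_λ(α) = diag(J_{λ₁}(α), J_{λ₂}(α), …)`, as an `n × n` matrix.
The equivalence `Composition.blocksFinEquiv` places the blocks consecutively along the diagonal. -/
def jordanForm {n : ℕ} (l : n.Partition) (α : ℂ) : Matrix (Fin n) (Fin n) ℂ :=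
  Matrix.reindex l.toComposition.blocksFinEquiv l.toComposition.blocksFinEquiv
    (Matrix.blockDiagonal' fun i => jordanBlock (l.toComposition.blocksFun i) α)

/-- `N_λ`: the Zariski closure of the union of the `GL_n`-orbits of the pairs
`(J_λ(0), B)` lying in `N_n`. -/
def nilComponent {n : ℕ} (l : n.Partition) : Set (MatPair n) :=
  closure {Q | ∃ (g : GL (Fin n) ℂ) (B : Matrix (Fin n) (Fin n) ℂ),
    (⟨jordanForm l 0, B⟩ : MatPair n) ∈ semiNilpotentVariety n ∧
      Q = MatPair.conj g ⟨jordanForm l 0, B⟩}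

/-! By Jordan normal form every point of the variety is conjugate to some `(J_λ(0), B)`, so the
variety is the finite union of the `N_λ`. It is closed because nilpotency is the polynomial
condition `A ^ n = 0`. Once the `N_λ` are known to be irreducible, of equal dimension and pairwise
distinct, none contains another, so they are exactly the components.

Dimension: the orbit of `J = J_λ(0)` has dimension `n² - s`, where `s` is the dimension of the
centralizer of `J`, and the fibre over `J` is the space of matrices anti-commuting with `J`. The
diagonal matrix `D` of signs alternating along each Jordan block is invertible and anti-commutes
with `J`, so `X ↦ D X` identifies the fibre with the centralizer and the total is `n² - s + s`.

`isPrime_and_ringKrullDim_conjOrbits` makes this algebraic. Restrict `g` to the affine slice `1 +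
L`, with `L` a linear complement of the centralizer; then `(g, B)` has `n²` free parameters. A
polynomial vanishing on the slice conjugates vanishes on all conjugates
(`aeval_conj_eq_zero_of_slice`), so the vanishing ideal is the kernel of a map to a rational
function field, hence prime. Conversely `g` is the unique solution of a linear system over the field
generated by the pair (`mem_of_unique_solution`), which recovers the parameters. The coordinate ring
therefore has transcendence degree `n²`, and this is its Krull dimension.

Distinctness: ranks of powers of `A` cannot increase in a closure, so `N_λ = N_μ` makes `∑ (λᵢ -
k)⁺` and `∑ (μᵢ - k)⁺` agree for all `k`; their second differences are the multiplicities of the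
parts. -/

/-! ### Krull dimension and transcendence degree -/

theorem ringKrullDim_eq_of_isIntegral_of_injective {R S : Type*} [CommRing R] [CommRing S]
    [IsDomain S] [Algebra R S] [Algebra.IsIntegral R S] (hinj : Function.Injective (algebraMap R S)) :
    ringKrullDim S = ringKrullDim R := by
  apply le_antisymm
  -- Incomparability: contraction of primes along an integral extension is strictly monotone.
  · exact Order.krullDim_le_of_strictMono (PrimeSpectrum.comap (algebraMap R S))
      fun p q hpq => Ideal.IsIntegral.comap_lt_comap hpq
  -- Lying over lifts the bottom of a chain of primes, going up lifts the rest.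
  · refine iSup_le fun l => ?_
    have : FaithfulSMul R S := (faithfulSMul_iff_algebraMap_injective R S).2 hinj
    obtain ⟨Q, hQ, hQ'⟩ := Ideal.exists_ideal_over_prime_of_isIntegral_of_isDomain
      (S := S) l.head.asIdeal (by
        rw [(RingHom.injective_iff_ker_eq_bot _).1 hinj]; exact bot_le)
    have : Q.LiesOver (RelSeries.head l).asIdeal := ⟨hQ'.symm⟩
    have : Algebra.HasGoingUp R S := inferInstance
    obtain ⟨L, hL, -⟩ := Ideal.exists_ltSeries_of_hasGoingUp l Q
    rw [← hL]
    exact Order.LTSeries.length_le_krullDim L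

/-- The Krull dimension of a finitely generated domain over a field is its transcendence degree. -/
theorem ringKrullDim_eq_of_trdeg_eq (k : Type*) {R : Type*} [Field k] [CommRing R] [IsDomain R]
    [Algebra k R] [Algebra.FiniteType k R] {N : ℕ} (h : Algebra.trdeg k R = N) :
    ringKrullDim R = N := by
  -- Noether normalization: `R` is integral over a polynomial ring in `s` variables, so both
  -- invariants equal `s`.
  obtain ⟨s, g, hg, hint⟩ := exists_integral_inj_algHom_of_fg k R
  algebraize [g.toRingHom]
  have hinj : Function.Injective (algebraMap (MvPolynomial (Fin s) k) R) := hg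
  have : Algebra.IsIntegral (MvPolynomial (Fin s) k) R := ⟨hint⟩
  have : FaithfulSMul (MvPolynomial (Fin s) k) R :=
    (faithfulSMul_iff_algebraMap_injective _ _).2 hinj
  have : IsScalarTower k (MvPolynomial (Fin s) k) R :=
    IsScalarTower.of_algebraMap_eq' (g.comp_algebraMap).symm
  have h1 := lift_trdeg_add_eq k (MvPolynomial (Fin s) k) R
  have h2 : Algebra.trdeg (MvPolynomial (Fin s) k) R = 0 := trdeg_eq_zero
  rw [h2, h, MvPolynomial.trdeg_of_isDomain] at h1
  simp at h1
  rw [ringKrullDim_eq_of_isIntegral_of_injective hinj,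
    MvPolynomial.ringKrullDim_of_isNoetherianRing, ringKrullDim_eq_zero_of_field]
  simp
  exact_mod_cast h1

/-- Closed subsets of a closed `Z` are closed in `X`. This passes from ambient irreducible sets to
the subtypes in which components and dimension are defined. -/
theorem IsIrreducible.preimage_val_of_isClosed {X : Type*} [TopologicalSpace X] {Z S : Set X}
    (hZ : IsClosed Z) (hS : IsIrreducible S) (hSZ : S ⊆ Z) :
    IsIrreducible (Subtype.val ⁻¹' S : Set Z) := by
  have himg : Subtype.val '' (Subtype.val ⁻¹' S : Set Z) = S := by
    rwa [Subtype.image_preimage_coe, Set.inter_eq_right]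
  refine ⟨?_, ?_⟩
  · rw [← Set.image_nonempty (f := Subtype.val), himg]
    exact hS.nonempty
  · rw [isPreirreducible_iff_isClosed_union_isClosed]
    intro Z1 Z2 hZ1 hZ2 h
    rw [← Set.image_subset_image_iff Subtype.val_injective, himg, Set.image_union] at h
    have := isPreirreducible_iff_isClosed_union_isClosed.1 hS.isPreirreducible _ _
      (hZ.isClosedMap_subtype_val _ hZ1) (hZ.isClosedMap_subtype_val _ hZ2) h
    rw [← himg, Set.image_subset_image_iff Subtype.val_injective,
      Set.image_subset_image_iff Subtype.val_injective] at this
    exact this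

/-! ### Dictionary between Zariski closed sets and ideals -/

namespace MatPair

variable {n : ℕ}

/-- Polynomials in the `2 n²` entries of a pair of matrices. -/
abbrev EntryPoly (n : ℕ) := MvPolynomial ((Fin n × Fin n) ⊕ (Fin n × Fin n)) ℂ

/-- The ideal of polynomials in the matrix entries that vanish on `Z`. -/
noncomputable def vanishingIdeal (Z : Set (MatPair n)) :
    Ideal (EntryPoly n) :=
  MvPolynomial.vanishingIdeal ℂ (coords '' Z)

theorem mem_vanishingIdeal {Z : Set (MatPair n)}
    {f : EntryPoly n} :
    f ∈ vanishingIdeal Z ↔ ∀ P ∈ Z, MvPolynomial.eval P.coords f = 0 := by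
  simp [vanishingIdeal, MvPolynomial.aeval_eq_eval]

theorem coords_surjective : Function.Surjective (coords (n := n)) := by
  intro x
  refine ⟨⟨Matrix.of fun i j => x (.inl (i, j)), Matrix.of fun i j => x (.inr (i, j))⟩, ?_⟩
  ext (⟨i, j⟩ | ⟨i, j⟩) <;> rfl

/-- The Nullstellensatz, transported along the bijection `coords`. -/
theorem vanishingIdeal_zeroLocus
    (Q : Ideal (EntryPoly n)) [Q.IsPrime] :
    vanishingIdeal (zeroLocus (Q : Set (EntryPoly n))) = Q := by
  have h : coords '' zeroLocus (Q : Set (EntryPoly n)) = MvPolynomial.zeroLocus ℂ Q := by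
    ext x
    obtain ⟨P, rfl⟩ := coords_surjective x
    constructor
    · rintro ⟨P', hP', h⟩
      rw [← h]
      exact fun f hf => by simpa [MvPolynomial.aeval_eq_eval] using hP' f hf
    · exact fun hP => ⟨P, fun f hf => by simpa [MvPolynomial.aeval_eq_eval] using hP f hf, rfl⟩
  rw [vanishingIdeal, h, MvPolynomial.IsPrime.vanishingIdeal_zeroLocus]

theorem closure_eq_zeroLocus (Z : Set (MatPair n)) :
    closure Z = zeroLocus (vanishingIdeal Z : Set (EntryPoly n)) := by
  apply subset_antisymm
  · refine closure_minimal (fun P hP f hf => ?_) ((isClosed_iff _).2 ⟨_, rfl⟩)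
    exact mem_vanishingIdeal.1 hf P hP
  · intro P hP
    obtain ⟨S, hS⟩ := (isClosed_iff (closure Z)).1 isClosed_closure
    rw [hS]
    intro f hf
    refine hP f (mem_vanishingIdeal.2 fun Q hQ => ?_)
    have := subset_closure hQ
    rw [hS] at this
    exact this f hf

theorem vanishingIdeal_closure (Z : Set (MatPair n)) :
    vanishingIdeal (closure Z) = vanishingIdeal Z := by
  apply le_antisymm
  · exact fun f hf => mem_vanishingIdeal.2 fun P hP =>
      mem_vanishingIdeal.1 hf P (subset_closure hP)
  · intro f hf
    refine mem_vanishingIdeal.2 fun P hP => ?_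
    rw [closure_eq_zeroLocus] at hP
    exact hP f hf

theorem zeroLocus_mono {S T : Set (EntryPoly n)}
    (h : S ⊆ T) : zeroLocus T ⊆ zeroLocus S := fun _ hP f hf => hP f (h hf)

theorem isIrreducible_of_isPrime {Z : Set (MatPair n)} (h : (vanishingIdeal Z).IsPrime) :
    IsIrreducible Z := by
  constructor
  · by_contra hne
    rw [Set.not_nonempty_iff_eq_empty] at hne
    apply h.ne_top
    rw [Ideal.eq_top_iff_one, mem_vanishingIdeal]
    simp [hne]
  · rw [isPreirreducible_iff_isClosed_union_isClosed]
    intro Z1 Z2 h1 h2 hZ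
    by_contra hcon
    push Not at hcon
    obtain ⟨⟨P, hP, hP1⟩, ⟨Q, hQ, hQ2⟩⟩ := hcon.imp Set.not_subset.1 Set.not_subset.1
    obtain ⟨S, rfl⟩ := (isClosed_iff _).1 h1
    obtain ⟨T, rfl⟩ := (isClosed_iff _).1 h2
    simp only [zeroLocus, Set.mem_ofPred_eq, not_forall] at hP1 hQ2
    obtain ⟨f, hf, hf0⟩ := hP1
    obtain ⟨g, hg, hg0⟩ := hQ2
    have : f * g ∈ vanishingIdeal Z := mem_vanishingIdeal.2 fun R hR => by
      rcases hZ hR with hR | hR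
      · simp [hR f hf]
      · simp [hR g hg]
    rcases h.mem_or_mem this with h | h
    · exact hf0 (mem_vanishingIdeal.1 h P hP)
    · exact hg0 (mem_vanishingIdeal.1 h Q hQ)

theorem isPrime_of_isIrreducible {Z : Set (MatPair n)} (h : IsIrreducible Z) :
    (vanishingIdeal Z).IsPrime := by
  refine ⟨?_, ?_⟩
  · rw [Ne, Ideal.eq_top_iff_one, mem_vanishingIdeal]
    intro h1
    obtain ⟨P, hP⟩ := h.nonempty
    simpa using h1 P hP
  · intro f g hfg
    have := isPreirreducible_iff_isClosed_union_isClosed.1 h.isPreirreducible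
      (zeroLocus {f}) (zeroLocus {g}) ((isClosed_iff _).2 ⟨_, rfl⟩) ((isClosed_iff _).2 ⟨_, rfl⟩)
      (fun P hP => by
        have := mem_vanishingIdeal.1 hfg P hP
        rw [map_mul, mul_eq_zero] at this
        simpa [zeroLocus] using this)
    refine this.imp (fun h => mem_vanishingIdeal.2 fun P hP => ?_)
      (fun h => mem_vanishingIdeal.2 fun P hP => ?_)
    · exact h hP f rfl
    · exact h hP g rfl

/-- Irreducible closed subsets of the closure correspond, reversing inclusion, to primes containing
the vanishing ideal; each direction of the correspondence gives one inequality. -/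
theorem topologicalKrullDim_closure (Z : Set (MatPair n)) :
    topologicalKrullDim (closure Z) =
      ringKrullDim (EntryPoly n ⧸ vanishingIdeal Z) := by
  rw [ringKrullDim_quotient, ← Order.krullDim_orderDual, topologicalKrullDim]
  have hval (C : TopologicalSpace.IrreducibleCloseds (closure Z)) :
      IsClosed (Subtype.val '' (C : Set (closure Z))) :=
    isClosed_closure.isClosedMap_subtype_val _ C.isClosed
  have hirr (C : TopologicalSpace.IrreducibleCloseds (closure Z)) :
      IsIrreducible (Subtype.val '' (C : Set (closure Z))) :=
    C.isIrreducible.image _ continuous_subtype_val.continuousOn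
  have hprime (C : TopologicalSpace.IrreducibleCloseds (closure Z)) :=
    isPrime_of_isIrreducible (hirr C)
  apply le_antisymm
  · refine Order.krullDim_le_of_strictMono (fun C => OrderDual.toDual
      ⟨⟨vanishingIdeal (Subtype.val '' (C : Set (closure Z))), hprime C⟩, ?_⟩) ?_
    · intro f hf
      refine mem_vanishingIdeal.2 ?_
      rintro _ ⟨P, hP, rfl⟩
      rw [← vanishingIdeal_closure] at hf
      exact mem_vanishingIdeal.1 hf P P.2
    · have key : ∀ C D : TopologicalSpace.IrreducibleCloseds (closure Z),
          vanishingIdeal (Subtype.val '' (D : Set (closure Z))) ≤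
            vanishingIdeal (Subtype.val '' (C : Set (closure Z))) ↔ C ≤ D := by
        intro C D
        constructor
        · intro h P hP
          have h1 := zeroLocus_mono (SetLike.coe_subset_coe.2 h)
          rw [← closure_eq_zeroLocus, ← closure_eq_zeroLocus, (hval C).closure_eq,
            (hval D).closure_eq] at h1
          exact (Set.image_subset_image_iff Subtype.val_injective).1 h1 hP
        · intro h f hf
          refine mem_vanishingIdeal.2 fun P hP => mem_vanishingIdeal.1 hf P ?_
          exact Set.image_mono h hP
      intro C D hCD
      rw [lt_iff_le_not_ge] at hCD ⊢
      exact ⟨(key C D).2 hCD.1, fun h => hCD.2 ((key D C).1 h)⟩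
  · have hsub (Q : (PrimeSpectrum.zeroLocus
        (vanishingIdeal Z : Set (EntryPoly n)))) :
        zeroLocus (Q.1.asIdeal : Set (EntryPoly n)) ⊆ closure Z := by
      rw [closure_eq_zeroLocus]
      exact zeroLocus_mono Q.2
    have himg (Q : (PrimeSpectrum.zeroLocus
        (vanishingIdeal Z : Set (EntryPoly n)))) :
        Subtype.val '' (Subtype.val ⁻¹' zeroLocus (Q.1.asIdeal : Set (EntryPoly n)) :
          Set (closure Z)) = zeroLocus (Q.1.asIdeal : Set (EntryPoly n)) := by
      rw [Subtype.image_preimage_coe, Set.inter_eq_right]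
      exact hsub Q
    refine Order.krullDim_le_of_strictMono (fun Q =>
      ⟨Subtype.val ⁻¹' zeroLocus ((OrderDual.ofDual Q).1.asIdeal : Set (EntryPoly n)),
        ?_, ?_⟩) ?_
    · have h1 : IsIrreducible (zeroLocus
          ((OrderDual.ofDual Q).1.asIdeal : Set (EntryPoly n))) := by
        apply isIrreducible_of_isPrime
        rw [vanishingIdeal_zeroLocus]
        exact (OrderDual.ofDual Q).1.isPrime
      exact h1.preimage_val_of_isClosed isClosed_closure (hsub (OrderDual.ofDual Q))
    · exact ((isClosed_iff _).2 ⟨_, rfl⟩).preimage continuous_subtype_val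
    · have key : ∀ Q R : (PrimeSpectrum.zeroLocus
          (vanishingIdeal Z : Set (EntryPoly n))),
          (Subtype.val ⁻¹' zeroLocus (Q.1.asIdeal : Set (EntryPoly n)) :
            Set (closure Z)) ⊆ Subtype.val ⁻¹' zeroLocus (R.1.asIdeal : Set (EntryPoly n)) ↔
          R ≤ Q := by
        intro Q R
        rw [← Set.image_subset_image_iff Subtype.val_injective, himg, himg]
        constructor
        · intro h
          change R.1.asIdeal ≤ Q.1.asIdeal
          rw [← vanishingIdeal_zeroLocus R.1.asIdeal, ← vanishingIdeal_zeroLocus Q.1.asIdeal]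
          exact fun f hf => mem_vanishingIdeal.2 fun P hP => mem_vanishingIdeal.1 hf P (h hP)
        · exact fun h => zeroLocus_mono h
      intro Q R hQR
      rw [lt_iff_le_not_ge] at hQR ⊢
      exact ⟨(key _ _).2 hQR.1, fun h => hQR.2 ((key _ _).1 h)⟩

end MatPair

/-! ### Linear algebra over field extensions, and the transversal slice -/

section

open Matrix

/-- The coordinates of a pair of matrices: the entries of `A`, then those of `B`. -/
def matrixEntries {R : Type*} {n : ℕ} (A B : Matrix (Fin n) (Fin n) R) :
    (Fin n × Fin n) ⊕ (Fin n × Fin n) → R :=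
  Sum.elim (fun ij => A ij.1 ij.2) (fun ij => B ij.1 ij.2)

/-- Functionals are written as traces because `X ↦ (Q * X).trace` still makes sense for matrices
over any `ℂ`-algebra. -/
theorem exists_trace_eq {n : ℕ} (φ : Matrix (Fin n) (Fin n) ℂ →ₗ[ℂ] ℂ) :
    ∃ Q : Matrix (Fin n) (Fin n) ℂ, ∀ X, φ X = (Q * X).trace := by
  refine ⟨Matrix.of fun b a => φ (Matrix.single a b 1), fun X => ?_⟩
  conv_lhs => rw [matrix_eq_sum_single X]
  simp only [map_sum, Matrix.trace, Matrix.diag, Matrix.mul_apply, Matrix.of_apply]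
  rw [Finset.sum_comm]
  refine Finset.sum_congr rfl fun j _ => Finset.sum_congr rfl fun i _ => ?_
  rw [← mul_one (X i j), ← smul_eq_mul, ← Matrix.smul_single, map_smul, smul_eq_mul, mul_comm,
    smul_eq_mul, mul_one]

/-- A basis of the space of matrices adapted to a subspace, with its dual basis expressed by
traces. -/
theorem exists_adapted_basis {n : ℕ} (W : Submodule ℂ (Matrix (Fin n) (Fin n) ℂ)) :
    ∃ (t : ℕ) (z Q : Fin (Module.finrank ℂ W) → Matrix (Fin n) (Fin n) ℂ)
      (l R : Fin t → Matrix (Fin n) (Fin n) ℂ),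
      Module.finrank ℂ W + t = n ^ 2 ∧ (∀ i, z i ∈ W) ∧
      (∀ X, X = ∑ i, (Q i * X).trace • z i + ∑ j, (R j * X).trace • l j) ∧
      (∀ X ∈ W, ∀ j, (R j * X).trace = 0) ∧
      (∀ i k, (Q i * z k).trace = if i = k then 1 else 0) ∧
      (∀ i j, (Q i * l j).trace = 0) ∧
      (∀ i j, (R i * l j).trace = if i = j then 1 else 0) := by
  obtain ⟨L, hL⟩ := Submodule.exists_isCompl W
  let bW := Module.finBasis ℂ W
  let bL := Module.finBasis ℂ L
  let b := (bW.prod bL).map (Submodule.prodEquivOfIsCompl W L hL)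
  choose q hq using fun i => exists_trace_eq (b.coord i)
  have hbl (i) : b (.inl i) = bW i := by simp [b]
  have hbr (i) : b (.inr i) = bL i := by simp [b]
  refine ⟨Module.finrank ℂ L, fun i => b (.inl i), fun i => q (.inl i), fun i => b (.inr i),
    fun i => q (.inr i), ?_, ?_, ?_, ?_, ?_, ?_, ?_⟩
  · rw [Submodule.finrank_add_eq_of_isCompl hL, Module.finrank_matrix]
    simp [sq]
  · intro i
    simp only [hbl]
    exact (bW i).2
  · intro X
    conv_lhs => rw [← b.sum_repr X, Fintype.sum_sum_type]
    simp only [← hq, Module.Basis.coord_apply]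
  · intro X hX j
    rw [← hq]
    have : X = Submodule.prodEquivOfIsCompl W L hL (⟨X, hX⟩, 0) := by simp
    rw [this]
    simp only [b, Module.Basis.coord_apply, Module.Basis.map_repr, LinearEquiv.trans_apply,
      LinearEquiv.symm_apply_apply]
    simp
  · intro i k
    rw [← hq]
    simp [Finsupp.single_apply, eq_comm]
  · intro i k
    rw [← hq]
    simp
  · intro i k
    rw [← hq]
    simp [Finsupp.single_apply, eq_comm]

section Retraction

variable {k K : Type*} [Field k] [Field K] [Algebra k K] {m : Type*} [Fintype m]
  (φ : K →ₗ[k] k)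

/-- A `k`-linear map `K → k`, applied entrywise, preserves linear systems with coefficients in `k`;
this is how solutions over `K` are brought down to `k`. -/
theorem map_linear_algebraMap_mul (M : Matrix m m k) (X : Matrix m m K) :
    (M.map (algebraMap k K) * X).map φ = M * X.map φ := by
  ext i j
  simp [Matrix.mul_apply, map_sum, ← Algebra.smul_def]

theorem map_linear_mul_algebraMap (M : Matrix m m k) (X : Matrix m m K) :
    (X * M.map (algebraMap k K)).map φ = X.map φ * M := by
  ext i j
  simp only [Matrix.mul_apply, Matrix.map_apply, map_sum]
  refine Finset.sum_congr rfl fun a _ => ?_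
  rw [mul_comm, ← Algebra.smul_def, map_smul, smul_eq_mul, mul_comm]

theorem trace_map_linear (X : Matrix m m K) : (X.map φ).trace = φ X.trace := by
  simp [Matrix.trace, map_sum]

end Retraction

/-- A linear expansion of the matrices commuting with `J` persists after field extension. -/
theorem eq_sum_of_commute_algebraMap {n s : ℕ} {K : Type*} [Field K] [Algebra ℂ K]
    {J : Matrix (Fin n) (Fin n) ℂ} {z Q : Fin s → Matrix (Fin n) (Fin n) ℂ}
    (h : ∀ X, J * X = X * J → X = ∑ i, (Q i * X).trace • z i)
    {X : Matrix (Fin n) (Fin n) K}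
    (hX : J.map (algebraMap ℂ K) * X = X * J.map (algebraMap ℂ K)) :
    X = ∑ i, ((Q i).map (algebraMap ℂ K) * X).trace • (z i).map (algebraMap ℂ K) := by
  ext a b
  -- `ℂ`-linear functionals separate the elements of `K`, and each one sends `X` to a complex matrix
  -- commuting with `J`.
  rw [← sub_eq_zero, ← Module.forall_dual_apply_eq_zero_iff ℂ]
  intro φ
  have h1 := h (X.map φ) (by
    rw [← map_linear_algebraMap_mul, hX, map_linear_mul_algebraMap])
  have h2 := congr_fun (congr_fun h1 a) b
  rw [map_sub, sub_eq_zero]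
  simp only [Matrix.sum_apply, Matrix.smul_apply, smul_eq_mul, Matrix.map_apply] at h2 ⊢
  rw [h2, map_sum]
  refine Finset.sum_congr rfl fun i _ => ?_
  rw [← map_linear_algebraMap_mul, trace_map_linear, mul_comm _ (algebraMap ℂ K _),
    ← Algebra.smul_def, map_smul, smul_eq_mul, mul_comm]

/-- A solution of a linear system with coefficients in `F` that is unique over `K` has entries
in `F`. -/
theorem mem_of_unique_solution {n s : ℕ} {K : Type*} [Field K] [Algebra ℂ K]
    (F : IntermediateField ℂ K)
    {J : Matrix (Fin n) (Fin n) ℂ} {Q : Fin s → Matrix (Fin n) (Fin n) ℂ}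
    {A g : Matrix (Fin n) (Fin n) K} (hA : ∀ i j, A i j ∈ F)
    (hg : g * J.map (algebraMap ℂ K) = A * g)
    (hgQ : ∀ i, ((Q i).map (algebraMap ℂ K) * g).trace = algebraMap ℂ K (Q i).trace)
    (huniq : ∀ h : Matrix (Fin n) (Fin n) K, h * J.map (algebraMap ℂ K) = A * h →
      (∀ i, ((Q i).map (algebraMap ℂ K) * h).trace = 0) → h = 0) (i j : Fin n) :
    g i j ∈ F := by
  -- For an `F`-linear retraction `φ : K → F`, the matrix `φ(g)` solves the same system as `g`, so
  -- uniqueness gives `g = φ(g)`.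
  obtain ⟨φ, hφ⟩ := (Algebra.linearMap F K).exists_leftInverse_of_injective
    (LinearMap.ker_eq_bot.2 (algebraMap F K).injective)
  have hφ' (x : F) : φ (algebraMap F K x) = x := LinearMap.congr_fun hφ x
  have hmap (M : Matrix (Fin n) (Fin n) ℂ) :
      M.map (algebraMap ℂ K) = (M.map (algebraMap ℂ F)).map (algebraMap F K) := by
    rw [Matrix.map_map]
    rfl
  let A' : Matrix (Fin n) (Fin n) F := Matrix.of fun i j => ⟨A i j, hA i j⟩
  have hA' : A = A'.map (algebraMap F K) := by ext i j; rfl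
  have hzero := huniq (g - (g.map φ).map (algebraMap F K)) ?_ ?_
  · have := congr_fun (congr_fun hzero i) j
    rw [Matrix.sub_apply, Matrix.zero_apply, sub_eq_zero] at this
    rw [this]
    exact (φ (g i j)).2
  · rw [sub_mul, mul_sub, hg]
    congr 1
    rw [hmap, hA', ← Matrix.map_mul, ← Matrix.map_mul, ← map_linear_algebraMap_mul,
      ← map_linear_mul_algebraMap, ← hA', ← hmap, hg]
  · intro k
    rw [mul_sub, Matrix.trace_sub, hgQ, sub_eq_zero, hmap, ← Matrix.map_mul,
      ← map_linear_algebraMap_mul, ← hmap]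
    have h1 : (((Q k).map (algebraMap ℂ K) * g).map φ).trace = algebraMap ℂ F (Q k).trace := by
      rw [trace_map_linear, hgQ, IsScalarTower.algebraMap_apply ℂ F K, hφ']
    have h2 := AddMonoidHom.map_trace (algebraMap F K).toAddMonoidHom
      (((Q k).map (algebraMap ℂ K) * g).map φ)
    rw [h1] at h2
    exact h2

/-- Evaluating a polynomial at a conjugated pair: denominators are powers of the determinant. -/
theorem exists_clear_det {n : ℕ} {R : Type} [CommRing R] [Algebra ℂ R]
    (G A B : Matrix (Fin n) (Fin n) R) (f : MatPair.EntryPoly n) :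
    ∃ (m : ℕ) (a : R), ∀ (S : Type) [Field S] [Algebra ℂ S] (ψ : R →ₐ[ℂ] S), ψ G.det ≠ 0 →
      ψ G.det ^ m * MvPolynomial.aeval (matrixEntries (G.map ψ * A.map ψ * (G.map ψ)⁻¹)
        (G.map ψ * B.map ψ * (G.map ψ)⁻¹)) f = ψ a := by
  induction f using MvPolynomial.induction_on with
  | C c => exact ⟨0, algebraMap ℂ R c, fun S _ _ ψ _ => by simp⟩
  | add f g hf hg =>
    obtain ⟨m1, a1, h1⟩ := hf
    obtain ⟨m2, a2, h2⟩ := hg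
    refine ⟨m1 + m2, G.det ^ m2 * a1 + G.det ^ m1 * a2, fun S _ _ ψ hψ => ?_⟩
    rw [map_add, map_add, map_mul, map_mul, map_pow, map_pow, ← h1 S ψ hψ, ← h2 S ψ hψ]
    ring
  | mul_X f i hf =>
    obtain ⟨m, a, h⟩ := hf
    -- Each further variable costs one factor `det G`, which turns the inverse into the adjugate.
    refine ⟨m + 1, a * matrixEntries (G * A * G.adjugate) (G * B * G.adjugate) i,
      fun S _ _ ψ hψ => ?_⟩
    rw [map_mul, map_mul, ← h S ψ hψ, MvPolynomial.aeval_X]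
    have hdet : (G.map ψ).det = ψ G.det := (AlgHom.map_det ψ G).symm
    have hadj : (G.adjugate).map ψ = (G.map ψ).adjugate := AlgHom.map_adjugate ψ G
    have hinv : ψ G.det • (G.map ψ)⁻¹ = (G.adjugate).map ψ := by
      rw [Matrix.inv_def, hdet, hadj, smul_smul, Ring.inverse_eq_inv', mul_inv_cancel₀ hψ, one_smul]
    have key (M : Matrix (Fin n) (Fin n) R) :
        ψ G.det • (G.map ψ * M.map ψ * (G.map ψ)⁻¹) = (G * M * G.adjugate).map ψ := by
      rw [← Matrix.mul_smul, hinv, Matrix.map_mul, Matrix.map_mul]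
    have : ψ G.det * matrixEntries (G.map ψ * A.map ψ * (G.map ψ)⁻¹)
        (G.map ψ * B.map ψ * (G.map ψ)⁻¹) i =
        ψ (matrixEntries (G * A * G.adjugate) (G * B * G.adjugate) i) := by
      rcases i with ⟨i, j⟩ | ⟨i, j⟩
      · exact congr_fun (congr_fun (key A) i) j
      · exact congr_fun (congr_fun (key B) i) j
    rw [← this]
    ring

theorem isUnit_det_of_ne_zero {n : ℕ} {F : Type*} [Field F] {M : Matrix (Fin n) (Fin n) F}
    (h : M.det ≠ 0) : IsUnit M.det := isUnit_iff_ne_zero.2 h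

theorem conj_mul_of_commute {n : ℕ} {g w J : Matrix (Fin n) (Fin n) ℂ} (hw : w.det ≠ 0)
    (hJ : J * w = w * J) : (g * w) * J * (g * w)⁻¹ = g * J * g⁻¹ := by
  rw [Matrix.mul_inv_rev, mul_assoc g w J, ← hJ]
  simp only [mul_assoc]
  rw [Matrix.mul_nonsing_inv_cancel_left _ _ (isUnit_det_of_ne_zero hw)]

/-- A polynomial vanishing on the conjugates of `(J, C)` by the matrices of an affine slice
transversal to the centralizer of `J` vanishes on all conjugates. -/
theorem aeval_conj_eq_zero_of_slice {n s : ℕ} {J : Matrix (Fin n) (Fin n) ℂ}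
    {z Q : Fin s → Matrix (Fin n) (Fin n) ℂ}
    (hz : ∀ i, J * z i = z i * J)
    (hzQ : ∀ i k, (Q i * z k).trace = if i = k then 1 else 0)
    (hone : (1 : Matrix (Fin n) (Fin n) ℂ) = ∑ i, (Q i).trace • z i)
    {f : MatPair.EntryPoly n}
    (hf : ∀ h : Matrix (Fin n) (Fin n) ℂ, h.det ≠ 0 → (∀ i, (Q i * h).trace = (Q i).trace) →
      ∀ C, J * C + C * J = 0 →
        MvPolynomial.aeval (matrixEntries (h * J * h⁻¹) (h * C * h⁻¹)) f = 0)
    {g : Matrix (Fin n) (Fin n) ℂ} (hg : g.det ≠ 0)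
    {C : Matrix (Fin n) (Fin n) ℂ} (hC : J * C + C * J = 0) :
    MvPolynomial.aeval (matrixEntries (g * J * g⁻¹) (g * C * g⁻¹)) f = 0 := by
  let ι : Matrix (Fin n) (Fin n) ℂ → Matrix (Fin n) (Fin n) (Polynomial ℂ) :=
    fun M => M.map Polynomial.C
  let ψ : ℂ → Polynomial ℂ →ₐ[ℂ] ℂ := fun τ => Polynomial.aeval τ
  have hψι (τ : ℂ) (M) : (ι M).map (ψ τ) = M := by
    ext i j; simp [ι, ψ]
  -- The line from `1` at `τ = 0`, which lies in the slice, to `g` at `τ = 1`.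
  let G := 1 + (Polynomial.X : Polynomial ℂ) • ι (g - 1)
  have hG (τ : ℂ) : G.map (ψ τ) = 1 + τ • (g - 1) := by
    have h1 : G.map (ψ τ) = (ψ τ).mapMatrix G := rfl
    rw [h1, map_add, map_one]
    congr 1
    ext i j
    simp [ι, ψ]
  have hG0 : G.map (ψ 0) = 1 := by rw [hG]; simp
  have hG1 : G.map (ψ 1) = g := by rw [hG]; simp
  let N : Matrix (Fin s) (Fin s) (Polynomial ℂ) :=
    Matrix.of fun i k => (ι (Q i) * G * ι (z k)).trace
  have hN (τ : ℂ) (i k) : ψ τ (N i k) = (Q i * G.map (ψ τ) * z k).trace := by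
    have h1 := AddMonoidHom.map_trace (ψ τ : Polynomial ℂ →+* ℂ).toAddMonoidHom
      (ι (Q i) * G * ι (z k))
    have h2 : (ι (Q i) * G * ι (z k)).map (ψ τ) = Q i * G.map (ψ τ) * z k := by
      rw [Matrix.map_mul, Matrix.map_mul, hψι, hψι]
    rw [← h2]
    exact h1
  let e : Fin s → Polynomial ℂ := fun i => Polynomial.C (Q i).trace
  -- Cramer's rule: up to the factor `det N`, the combination `w = ∑ uₖ zₖ` in the centralizer moves
  -- `G` into the slice.
  let u := N.adjugate *ᵥ e
  have hNu : N *ᵥ u = N.det • e := by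
    simp only [u, Matrix.mulVec_mulVec, Matrix.mul_adjugate, Matrix.smul_mulVec, Matrix.one_mulVec]
  let w := ∑ k, u k • ι (z k)
  have hw (τ : ℂ) : w.map (ψ τ) = ∑ k, ψ τ (u k) • z k := by
    have h1 : w.map (ψ τ) = (ψ τ).mapMatrix w := rfl
    rw [h1, map_sum]
    refine Finset.sum_congr rfl fun k _ => ?_
    ext i j
    simp [ι, ψ]
  have hdet (τ : ℂ) (M : Matrix (Fin n) (Fin n) (Polynomial ℂ)) :
      ψ τ M.det = (M.map (ψ τ)).det := AlgHom.map_det (ψ τ) M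
  have hN0 : N.map (ψ 0) = 1 := by
    ext i k
    rw [Matrix.map_apply, hN, hG0, mul_one, hzQ, Matrix.one_apply]
  have hNd0 : ψ 0 N.det = 1 := by
    rw [AlgHom.map_det]
    change (N.map (ψ 0)).det = 1
    rw [hN0, det_one]
  have hu0 (k) : ψ 0 (u k) = (Q k).trace := by
    have h1 : N.adjugate.map (ψ 0) = 1 := by
      have := AlgHom.map_adjugate (ψ 0) N
      change N.adjugate.map (ψ 0) = (N.map (ψ 0)).adjugate at this
      rw [this, hN0, adjugate_one]
    have h2 : ψ 0 (u k) = (N.adjugate.map (ψ 0) *ᵥ fun i => ψ 0 (e i)) k := by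
      simp [u, Matrix.mulVec, dotProduct, map_sum]
    rw [h2, h1, Matrix.one_mulVec]
    simp [e, ψ]
  have hw0 : w.map (ψ 0) = 1 := by
    rw [hw, hone]
    simp only [hu0]
  obtain ⟨m, a, ha⟩ := exists_clear_det G (ι J) (ι C) f
  -- Where the three determinants are nonzero, `G v` is invertible and in the slice. Since `v`
  -- commutes with `J`, the pair `(J, C)` conjugated by `G` is `(J, v⁻¹ C v)` conjugated by `G v`,
  -- and `hf` applies.
  have key : a * (N.det * w.det * G.det) = 0 := by
    refine Polynomial.funext fun τ => ?_
    rw [← Polynomial.coe_aeval_eq_eval]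
    change ψ τ _ = ψ τ 0
    rw [map_zero, map_mul]
    by_contra hne
    obtain ⟨hane, hdne⟩ := mul_ne_zero_iff.1 hne
    rw [map_mul, map_mul] at hdne
    obtain ⟨hd1, hGne⟩ := mul_ne_zero_iff.1 hdne
    obtain ⟨hNne, hwne⟩ := mul_ne_zero_iff.1 hd1
    apply hane
    rw [← ha ℂ (ψ τ) hGne, hψι, hψι]
    rw [hdet] at hwne hGne
    set gt := G.map (ψ τ)
    set ν := ψ τ N.det
    set v := ν⁻¹ • w.map (ψ τ) with hv
    have hvdet : v.det ≠ 0 := by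
      rw [hv, Matrix.det_smul]
      exact mul_ne_zero (pow_ne_zero _ (inv_ne_zero hNne)) hwne
    have hJv : J * v = v * J := by
      rw [hv, hw, Matrix.mul_smul, Matrix.smul_mul, Matrix.mul_sum, Matrix.sum_mul]
      simp only [Matrix.mul_smul, Matrix.smul_mul, hz]
    have hvu := isUnit_det_of_ne_zero hvdet
    have hJvi : J * v⁻¹ = v⁻¹ * J := by
      have h1 : v⁻¹ * (J * v) * v⁻¹ = v⁻¹ * (v * J) * v⁻¹ := by rw [hJv]
      rw [Matrix.nonsing_inv_mul_cancel_left _ _ hvu, ← mul_assoc,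
        Matrix.mul_nonsing_inv_cancel_right _ _ hvu] at h1
      exact h1.symm
    have h1 := hf (gt * v) (by rw [det_mul]; exact mul_ne_zero hGne hvdet) (fun i => by
        have h2 : ∑ k, ψ τ (N i k) * ψ τ (u k) = ν * (Q i).trace := by
          have := congr_arg (ψ τ) (congr_fun hNu i)
          simpa [Matrix.mulVec, dotProduct, e, ψ, ν] using this
        rw [hv, hw, Matrix.mul_smul, Matrix.mul_smul, Matrix.trace_smul, Matrix.mul_sum,
          Matrix.mul_sum, Matrix.trace_sum]
        simp only [Matrix.mul_smul, Matrix.trace_smul, ← mul_assoc, smul_eq_mul]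
        simp only [hN] at h2
        simp only [mul_comm (ψ τ (u _))]
        rw [h2, inv_mul_cancel_left₀ hNne]) (v⁻¹ * C * v) (by
        have : J * (v⁻¹ * C * v) + v⁻¹ * C * v * J = v⁻¹ * (J * C + C * J) * v := by
          rw [mul_assoc _ v J, ← hJv, mul_add, add_mul, ← mul_assoc, ← mul_assoc, hJvi]
          simp only [mul_assoc]
        rw [this, hC]
        simp)
    rw [conj_mul_of_commute hvdet hJv] at h1
    have h3 : gt * v * (v⁻¹ * C * v) * (gt * v)⁻¹ = gt * C * gt⁻¹ := by
      rw [Matrix.mul_inv_rev]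
      simp only [mul_assoc]
      rw [Matrix.mul_nonsing_inv_cancel_left _ _ hvu, Matrix.mul_nonsing_inv_cancel_left _ _ hvu]
    rw [h3] at h1
    rw [h1, mul_zero]
  -- At `τ = 0` all three matrices are the identity.
  have hdne : N.det * w.det * G.det ≠ 0 := by
    intro h
    have := congr_arg (ψ 0) h
    rw [map_mul, map_mul, hNd0, hdet, hdet, hw0, hG0] at this
    simp at this
  have ha0 := (mul_eq_zero.1 key).resolve_right hdne
  have hg' : ψ 1 G.det ≠ 0 := by rwa [hdet, hG1]
  have h1 := ha ℂ (ψ 1) hg'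
  rw [ha0, map_zero, hψι, hψι, hG1] at h1
  exact (mul_eq_zero.1 h1).resolve_left (pow_ne_zero _ hg')

/-- The union of the orbits, under simultaneous conjugation, of the anti-commuting pairs `(J, B)`. -/
def conjOrbits {n : ℕ} (J : Matrix (Fin n) (Fin n) ℂ) : Set (MatPair n) :=
  {P | ∃ (g : GL (Fin n) ℂ) (B : Matrix (Fin n) (Fin n) ℂ),
    J * B + B * J = 0 ∧ P = MatPair.conj g ⟨J, B⟩}

/-! ### Irreducibility and dimension of the conjugates of anti-commuting pairs -/

theorem mem_vanishingIdeal_conjOrbits {n : ℕ} {J : Matrix (Fin n) (Fin n) ℂ}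
    {f : MatPair.EntryPoly n} :
    f ∈ MatPair.vanishingIdeal (conjOrbits J) ↔
      ∀ h : Matrix (Fin n) (Fin n) ℂ, h.det ≠ 0 → ∀ C, J * C + C * J = 0 →
        MvPolynomial.aeval (matrixEntries (h * J * h⁻¹) (h * C * h⁻¹)) f = 0 := by
  rw [MatPair.mem_vanishingIdeal]
  constructor
  · intro hf h hh C hC
    have := hf (MatPair.conj (Matrix.GeneralLinearGroup.mkOfDetNeZero h hh) ⟨J, C⟩)
      ⟨_, _, hC, rfl⟩
    rw [← MvPolynomial.coe_aeval_eq_eval] at this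
    rw [← this, MatPair.conj, Matrix.coe_units_inv]
    rfl
  · rintro hf _ ⟨g, C, hC, rfl⟩
    have := hf g (by
      have := (Matrix.isUnit_iff_isUnit_det _).1 g.isUnit
      exact this.ne_zero) C hC
    rw [← Matrix.coe_units_inv] at this
    rw [← MvPolynomial.coe_aeval_eq_eval, ← this]
    rfl

/-- The matrices commuting with `J`. -/
def commutingMatrices {n : ℕ} (J : Matrix (Fin n) (Fin n) ℂ) :
    Submodule ℂ (Matrix (Fin n) (Fin n) ℂ) :=
  LinearMap.ker (LinearMap.mulLeft ℂ J - LinearMap.mulRight ℂ J)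

/-- The matrices anti-commuting with `J`. -/
def antiCommutingMatrices {n : ℕ} (J : Matrix (Fin n) (Fin n) ℂ) :
    Submodule ℂ (Matrix (Fin n) (Fin n) ℂ) :=
  LinearMap.ker (LinearMap.mulLeft ℂ J + LinearMap.mulRight ℂ J)

theorem mem_commutingMatrices {n : ℕ} {J X : Matrix (Fin n) (Fin n) ℂ} :
    X ∈ commutingMatrices J ↔ J * X = X * J := by
  simp [commutingMatrices, sub_eq_zero]

theorem mem_antiCommutingMatrices {n : ℕ} {J X : Matrix (Fin n) (Fin n) ℂ} :
    X ∈ antiCommutingMatrices J ↔ J * X + X * J = 0 := by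
  simp [antiCommutingMatrices]

/-- Left multiplication by `D` is injective and exchanges the two spaces. -/
theorem finrank_antiCommutingMatrices {n : ℕ} {J D : Matrix (Fin n) (Fin n) ℂ} (hD : D.det ≠ 0)
    (hDJ : D * J = -(J * D)) :
    Module.finrank ℂ (antiCommutingMatrices J) = Module.finrank ℂ (commutingMatrices J) := by
  have hinj : Function.Injective (LinearMap.mulLeft ℂ D) := fun X Y h => by
    have h1 : D⁻¹ * (D * X) = D⁻¹ * (D * Y) := congr_arg _ h
    rwa [Matrix.nonsing_inv_mul_cancel_left _ _ (isUnit_iff_ne_zero.2 hD),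
      Matrix.nonsing_inv_mul_cancel_left _ _ (isUnit_iff_ne_zero.2 hD)] at h1
  have hJD : J * D = -(D * J) := by rw [hDJ, neg_neg]
  apply le_antisymm
  · refine LinearMap.finrank_le_finrank_of_injective
      (f := (LinearMap.mulLeft ℂ D).restrict (p := antiCommutingMatrices J)
        (q := commutingMatrices J) fun X hX => ?_) fun X Y h => ?_
    · rw [mem_antiCommutingMatrices] at hX
      rw [mem_commutingMatrices, LinearMap.mulLeft_apply, ← mul_assoc, hJD, neg_mul, mul_assoc,
        eq_neg_of_add_eq_zero_left hX, mul_neg, neg_neg, mul_assoc]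
    · exact Subtype.ext (hinj (congr_arg Subtype.val h))
  · refine LinearMap.finrank_le_finrank_of_injective
      (f := (LinearMap.mulLeft ℂ D).restrict (p := commutingMatrices J)
        (q := antiCommutingMatrices J) fun X hX => ?_) fun X Y h => ?_
    · rw [mem_commutingMatrices] at hX
      rw [mem_antiCommutingMatrices, LinearMap.mulLeft_apply, ← mul_assoc, hJD, neg_mul,
        mul_assoc, hX, mul_assoc, neg_add_cancel]
    · exact Subtype.ext (hinj (congr_arg Subtype.val h))

/-- The elements of a field that are algebraic over a subring. -/
noncomputable def algebraicElements {k K : Type*} [Field k] [Field K] [Algebra k K]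
    (T : Subalgebra k K) : IntermediateField k K where
  __ := (Subalgebra.algebraicClosure T K).restrictScalars k
  inv_mem' := fun _ hx => IsAlgebraic.inv hx

theorem mem_algebraicElements {k K : Type*} [Field k] [Field K] [Algebra k K]
    {T : Subalgebra k K} {x : K} : x ∈ algebraicElements T ↔ IsAlgebraic T x := Iff.rfl

section EntriesMem

variable {k K : Type*} [Field k] [Field K] [Algebra k K] {n : ℕ} (F : IntermediateField k K)

theorem mul_entries_mem {M N : Matrix (Fin n) (Fin n) K} (hM : ∀ i j, M i j ∈ F)
    (hN : ∀ i j, N i j ∈ F) (i j : Fin n) : (M * N) i j ∈ F := by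
  rw [Matrix.mul_apply]
  exact sum_mem fun a _ => mul_mem (hM _ _) (hN _ _)

theorem inv_entries_mem {M : Matrix (Fin n) (Fin n) K} (hM : ∀ i j, M i j ∈ F) (i j : Fin n) :
    M⁻¹ i j ∈ F := by
  let M' : Matrix (Fin n) (Fin n) F := Matrix.of fun i j => ⟨M i j, hM i j⟩
  have hM' : M = (algebraMap F K).mapMatrix M' := by ext i j; rfl
  rw [hM', Matrix.inv_def, ← RingHom.map_det, ← RingHom.map_adjugate, Ring.inverse_eq_inv',
    ← map_inv₀]
  exact mul_mem (M'.det⁻¹).2 (M'.adjugate i j).2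

theorem trace_mem {M : Matrix (Fin n) (Fin n) K} (hM : ∀ i j, M i j ∈ F) : M.trace ∈ F :=
  sum_mem fun i _ => hM i i

theorem map_entries_mem (M : Matrix (Fin n) (Fin n) k) (i j : Fin n) :
    M.map (algebraMap k K) i j ∈ F := F.algebraMap_mem _

end EntriesMem

theorem trdeg_fractionRing_mvPolynomial (σ : Type) [Finite σ] :
    Algebra.trdeg ℂ (FractionRing (MvPolynomial σ ℂ)) = Nat.card σ := by
  have h1 := trdeg_add_eq ℂ (MvPolynomial σ ℂ) (A := FractionRing (MvPolynomial σ ℂ))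
  have : Algebra.IsAlgebraic (MvPolynomial σ ℂ) (FractionRing (MvPolynomial σ ℂ)) :=
    IsLocalization.isAlgebraic _ (nonZeroDivisors _)
  rw [← h1, MvPolynomial.trdeg_of_isDomain, trdeg_eq_zero]
  simp [Nat.cast_card]

/-- Additivity of transcendence degree in the tower `k ⊆ T ⊆ K`, whose upper step contributes zero.
-/
theorem trdeg_subalgebra_eq {k K : Type} [Field k] [Field K] [Algebra k K] (T : Subalgebra k K)
    [Algebra.IsAlgebraic T K] : Algebra.trdeg k T = Algebra.trdeg k K := by
  have : FaithfulSMul k T :=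
    (faithfulSMul_iff_algebraMap_injective k T).2 (algebraMap k T).injective
  have h1 := trdeg_add_eq k T (A := K)
  have h2 : Algebra.trdeg T K = 0 := trdeg_eq_zero
  rwa [h2, add_zero] at h1

/-- If an invertible matrix anti-commutes with `J`, the orbits of the anti-commuting pairs `(J, B)`
sweep out an irreducible set of dimension `n²`. The rational parametrization
`(g, B) ↦ (g J g⁻¹, g B g⁻¹)` is birational once `g` is restricted to an affine slice transversal
to the centralizer of `J`. -/
theorem isPrime_and_ringKrullDim_conjOrbits {n : ℕ} {J D : Matrix (Fin n) (Fin n) ℂ} (hD : D.det ≠ 0)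
    (hDJ : D * J = -(J * D)) :
    (MatPair.vanishingIdeal (conjOrbits J)).IsPrime ∧
      ringKrullDim (MatPair.EntryPoly n ⧸ MatPair.vanishingIdeal (conjOrbits J)) =
        ((n ^ 2 : ℕ) : WithBot ℕ∞) := by
  obtain ⟨t, z, Q, l, R, hst, hz, hexp, hR, hQz, hQl, hRl⟩ :=
    exists_adapted_basis (commutingMatrices J)
  obtain ⟨t', v, S, l', S', -, hv, hexpV, hS', hSv, -, -⟩ :=
    exists_adapted_basis (antiCommutingMatrices J)
  have hrank := finrank_antiCommutingMatrices hD hDJ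
  simp only [mem_commutingMatrices] at hz hR
  simp only [mem_antiCommutingMatrices] at hv hS'
  have hcomm : ∀ X, J * X = X * J → X = ∑ i, (Q i * X).trace • z i := fun X hX => by
    conv_lhs => rw [hexp X]
    simp [hR X hX]
  have hanti : ∀ X, J * X + X * J = 0 → X = ∑ i, (S i * X).trace • v i := fun X hX => by
    conv_lhs => rw [hexpV X]
    simp [hS' X hX]
  have hone : (1 : Matrix (Fin n) (Fin n) ℂ) = ∑ i, (Q i).trace • z i := by
    simpa using hcomm 1 (by simp)
  -- One variable for each dimension of the complement `L` and of the anti-commuting space, hence `t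
  -- + s = n²` in all.
  let σ := Fin t ⊕ Fin (Module.finrank ℂ (antiCommutingMatrices J))
  have hσ : Nat.card σ = n ^ 2 := by
    rw [← hst, ← hrank]
    simp [σ, add_comm]
  let Pl := MvPolynomial σ ℂ
  let K := FractionRing Pl
  let ψ : Pl →ₐ[ℂ] K := IsScalarTower.toAlgHom ℂ Pl K
  have hψ : Function.Injective ψ := IsFractionRing.injective Pl K
  let ι : Matrix (Fin n) (Fin n) ℂ → Matrix (Fin n) (Fin n) Pl := fun M => M.map MvPolynomial.C
  let κ : Matrix (Fin n) (Fin n) ℂ → Matrix (Fin n) (Fin n) K := fun M => M.map (algebraMap ℂ K)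
  have hικ (M) : (ι M).map ψ = κ M := by
    ext i j
    exact ψ.commutes (M i j)
  let g : Matrix (Fin n) (Fin n) Pl := 1 + ∑ j, (MvPolynomial.X (Sum.inl j) : Pl) • ι (l j)
  let c : Matrix (Fin n) (Fin n) Pl := ∑ k, (MvPolynomial.X (Sum.inr k) : Pl) • ι (v k)
  -- specializations of the generic point
  let ev : (σ → ℂ) → Pl →ₐ[ℂ] ℂ := fun x => MvPolynomial.aeval x
  have hev (x) (M) : (ι M).map (ev x) = M := by
    ext i j
    exact MvPolynomial.aeval_C x (M i j)
  have hevsmul (x) (i : σ) (M) : (ev x).mapMatrix ((MvPolynomial.X i : Pl) • ι M) = x i • M := by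
    ext a b
    simp only [AlgHom.mapMatrix_apply, Matrix.map_apply, Matrix.smul_apply, smul_eq_mul, map_mul]
    exact congr_arg₂ _ (MvPolynomial.aeval_X x i) (MvPolynomial.aeval_C x (M a b))
  have hgx (x) : g.map (ev x) = 1 + ∑ j, x (.inl j) • l j := by
    have h1 : g.map (ev x) = (ev x).mapMatrix g := rfl
    rw [h1, map_add, map_one, map_sum]
    simp only [hevsmul]
  have hcx (x) : c.map (ev x) = ∑ k, x (.inr k) • v k := by
    have h1 : c.map (ev x) = (ev x).mapMatrix c := rfl
    rw [h1, map_sum]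
    simp only [hevsmul]
  have hg0 : g.map (ev 0) = 1 := by rw [hgx]; simp
  have hdet (x) : ev x g.det = (g.map (ev x)).det := AlgHom.map_det (ev x) g
  have hgdet : g.det ≠ 0 := by
    intro h
    have := hdet 0
    rw [h, hg0] at this
    simp at this
  have hgψ : ψ g.det ≠ 0 := fun h => hgdet (hψ (by rw [h, map_zero]))
  -- the generic point
  let gK := g.map ψ
  have hgKdet : gK.det ≠ 0 := by
    have := AlgHom.map_det ψ g
    change _ = gK.det at this
    rwa [← this]
  have hgKu := isUnit_det_of_ne_zero hgKdet
  let cK := c.map ψ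
  let A := gK * κ J * gK⁻¹
  let B := gK * cK * gK⁻¹
  let Φ : MatPair.EntryPoly n →ₐ[ℂ] K := MvPolynomial.aeval (matrixEntries A B)
  have hker : MatPair.vanishingIdeal (conjOrbits J) = RingHom.ker Φ := by
    ext f
    rw [mem_vanishingIdeal_conjOrbits, RingHom.mem_ker]
    obtain ⟨m, a, ha⟩ := exists_clear_det g (ι J) c f
    have haK := ha K ψ hgψ
    rw [hικ] at haK
    change ψ g.det ^ m * Φ f = ψ a at haK
    constructor
    · intro hf
      -- Every specialization with `det g ≠ 0` is a point of the orbits, so this polynomial vanishes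
      -- at all complex points.
      have h1 : a * g.det = 0 := by
        refine MvPolynomial.funext fun x => ?_
        rw [map_zero, map_mul, mul_eq_zero]
        by_contra! hcon
        rw [← MvPolynomial.coe_aeval_eq_eval] at hcon
        obtain ⟨h1, h2⟩ := hcon
        apply h1
        have h3 := ha ℂ (ev x) h2
        change ev x a = 0
        rw [← h3, hev, hf _ (by rw [← hdet]; exact h2), mul_zero]
        rw [hcx]
        simp only [Matrix.mul_sum, Matrix.sum_mul, ← Finset.sum_add_distrib, Matrix.mul_smul,
          Matrix.smul_mul, ← smul_add, hv, smul_zero, Finset.sum_const_zero]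
      rw [(mul_eq_zero.1 h1).resolve_right hgdet, map_zero] at haK
      exact (mul_eq_zero.1 haK).resolve_left (pow_ne_zero _ hgψ)
    · intro hf h hh C hC
      rw [hf, mul_zero] at haK
      have ha0 : a = 0 := hψ (by rw [← haK, map_zero])
      refine aeval_conj_eq_zero_of_slice hz hQz hone (fun h hh hQh C hC => ?_) hh hC
      -- The trace conditions kill the centralizer components of `h - 1`, so `h` and `C` are the
      -- specialization of `g` and `c` at these coordinates.
      let x : σ → ℂ := Sum.elim (fun j => (R j * (h - 1)).trace) (fun k => (S k * C).trace)
      have hx1 : g.map (ev x) = h := by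
        rw [hgx, ← eq_sub_iff_add_eq', hexp (h - 1)]
        simp [x, mul_sub, hQh]
      have hx2 : c.map (ev x) = C := by
        rw [hcx]
        exact (hanti C hC).symm
      have hne : ev x g.det ≠ 0 := by rwa [hdet, hx1]
      have h1 := ha ℂ (ev x) hne
      rw [ha0, map_zero, hev, hx1, hx2] at h1
      exact (mul_eq_zero.1 h1).resolve_left (pow_ne_zero _ hne)
  rw [hker]
  refine ⟨RingHom.ker_isPrime Φ.toRingHom, ?_⟩
  rw [ringKrullDim_eq_of_ringEquiv (Ideal.quotientKerEquivRange Φ).toRingEquiv]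
  have : Algebra.FiniteType ℂ Φ.range :=
    Algebra.FiniteType.of_surjective Φ.rangeRestrict Φ.rangeRestrict_surjective
  refine ringKrullDim_eq_of_trdeg_eq ℂ ?_
  have hAmem (i j) : A i j ∈ algebraicElements Φ.range :=
    isAlgebraic_algebraMap (⟨A i j, MvPolynomial.X (.inl (i, j)),
      MvPolynomial.aeval_X _ _⟩ : Φ.range)
  have hBmem (i j) : B i j ∈ algebraicElements Φ.range :=
    isAlgebraic_algebraMap (⟨B i j, MvPolynomial.X (.inr (i, j)),
      MvPolynomial.aeval_X _ _⟩ : Φ.range)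
  have hψX (i : σ) (M) : ψ.mapMatrix ((MvPolynomial.X i : Pl) • ι M) =
      ψ (MvPolynomial.X i) • κ M := by
    ext a b
    simp only [AlgHom.mapMatrix_apply, Matrix.map_apply, Matrix.smul_apply, smul_eq_mul, map_mul]
    exact congr_arg _ (ψ.commutes (M a b))
  have hgK : gK = 1 + ∑ j, ψ (MvPolynomial.X (.inl j)) • κ (l j) := by
    have h1 : gK = ψ.mapMatrix g := rfl
    rw [h1, map_add, map_one, map_sum]
    simp only [hψX]
  have hcK : cK = ∑ k, ψ (MvPolynomial.X (.inr k)) • κ (v k) := by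
    have h1 : cK = ψ.mapMatrix c := rfl
    rw [h1, map_sum]
    simp only [hψX]
  have hκtr (M N) : (κ M * κ N).trace = algebraMap ℂ K (M * N).trace := by
    simp only [κ]
    rw [← Matrix.map_mul]
    exact (AddMonoidHom.map_trace (algebraMap ℂ K).toAddMonoidHom (M * N)).symm
  have hκtr1 (M) : (κ M).trace = algebraMap ℂ K M.trace :=
    (AddMonoidHom.map_trace (algebraMap ℂ K).toAddMonoidHom M).symm
  have hgKQ (i) : (κ (Q i) * gK).trace = algebraMap ℂ K (Q i).trace := by
    rw [hgK, mul_add, mul_one, Matrix.trace_add, Matrix.mul_sum, Matrix.trace_sum, hκtr1]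
    simp only [Matrix.mul_smul, Matrix.trace_smul, hκtr, hQl, map_zero, smul_zero,
      Finset.sum_const_zero, add_zero]
  -- uniqueness of the intertwiner lying in the slice
  let N : Matrix (Fin (Module.finrank ℂ (commutingMatrices J)))
    (Fin (Module.finrank ℂ (commutingMatrices J))) Pl :=
    Matrix.of fun i k => (ι (Q i) * g * ι (z k)).trace
  have hN0 : N.map (ev 0) = 1 := by
    ext i k
    have h1 := AddMonoidHom.map_trace (ev 0 : Pl →+* ℂ).toAddMonoidHom
      (ι (Q i) * g * ι (z k))
    have h2 : (ι (Q i) * g * ι (z k)).map (ev 0) = Q i * z k := by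
      rw [Matrix.map_mul, Matrix.map_mul, hev, hev, hg0, mul_one]
    rw [Matrix.one_apply, ← hQz, ← h2]
    exact h1
  have hNdet : N.det ≠ 0 := by
    intro h
    have h1 := AlgHom.map_det (ev 0) N
    change _ = (N.map (ev 0)).det at h1
    rw [h, hN0] at h1
    simp at h1
  have hNK (i k) : ψ (N i k) = (κ (Q i) * gK * κ (z k)).trace := by
    have h1 := AddMonoidHom.map_trace (ψ : Pl →+* K).toAddMonoidHom
      (ι (Q i) * g * ι (z k))
    have h2 : (ι (Q i) * g * ι (z k)).map ψ = κ (Q i) * gK * κ (z k) := by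
      rw [Matrix.map_mul, Matrix.map_mul, hικ, hικ]
    rw [← h2]
    exact h1
  -- `g⁻¹ h` commutes with `J`, so it is `∑ yₖ zₖ`; the trace conditions read `N y = 0`, and `det N
  -- ≠ 0` because `N` specializes to the identity at the origin.
  have huniq : ∀ h : Matrix (Fin n) (Fin n) K, h * κ J = A * h →
      (∀ i, (κ (Q i) * h).trace = 0) → h = 0 := by
    intro h hh hQh
    have h1 := eq_sum_of_commute_algebraMap (K := K) hcomm (X := gK⁻¹ * h) (by
      change κ J * (gK⁻¹ * h) = gK⁻¹ * h * κ J
      rw [mul_assoc, hh]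
      simp only [A, mul_assoc]
      rw [Matrix.nonsing_inv_mul_cancel_left _ _ hgKu])
    set y : Fin (Module.finrank ℂ (commutingMatrices J)) → K :=
      fun i => (κ (Q i) * (gK⁻¹ * h)).trace
    change gK⁻¹ * h = ∑ i, y i • κ (z i) at h1
    have h2 : h = gK * ∑ i, y i • κ (z i) := by
      rw [← h1, Matrix.mul_nonsing_inv_cancel_left _ _ hgKu]
    have h3 : (N.map ψ) *ᵥ y = 0 := by
      ext i
      have h4 := hQh i
      rw [h2, Matrix.mul_sum, Matrix.mul_sum, Matrix.trace_sum] at h4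
      simp only [Matrix.mul_smul, Matrix.trace_smul, ← mul_assoc, smul_eq_mul] at h4
      rw [Pi.zero_apply, ← h4]
      simp only [Matrix.mulVec, dotProduct, Matrix.map_apply, hNK, mul_comm (y _)]
    have h5 : (N.map ψ).det ≠ 0 := by
      have h6 := AlgHom.map_det ψ N
      change _ = (N.map ψ).det at h6
      rw [← h6]
      exact fun h7 => hNdet (hψ (by rw [h7, map_zero]))
    have h8 := Matrix.eq_zero_of_mulVec_eq_zero h5 h3
    rw [h2, h8]
    simp
  have hgmem := mem_of_unique_solution (algebraicElements Φ.range) hAmem (g := gK) (J := J)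
    (Q := Q) (by
      change gK * κ J = A * gK
      simp only [A]
      rw [Matrix.nonsing_inv_mul_cancel_right _ _ hgKu]) hgKQ huniq
  have hcmem : ∀ i j, cK i j ∈ algebraicElements Φ.range := by
    have h1 : cK = gK⁻¹ * B * gK := by
      simp only [B]
      rw [mul_assoc, Matrix.nonsing_inv_mul_cancel_right _ _ hgKu,
        Matrix.nonsing_inv_mul_cancel_left _ _ hgKu]
    rw [h1]
    exact mul_entries_mem _ (mul_entries_mem _ (inv_entries_mem _ hgmem) hBmem) hgmem
  have hXmem (i : σ) : ψ (MvPolynomial.X i) ∈ algebraicElements Φ.range := by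
    rcases i with j | k
    · have h1 : ψ (MvPolynomial.X (.inl j)) = (κ (R j) * (gK - 1)).trace := by
        rw [hgK, add_sub_cancel_left, Matrix.mul_sum, Matrix.trace_sum]
        simp [Matrix.trace_smul, hκtr, hRl]
      rw [h1]
      refine trace_mem _ (mul_entries_mem _ (map_entries_mem _ _) fun a b => ?_)
      rw [Matrix.sub_apply, Matrix.one_apply]
      refine sub_mem (hgmem a b) ?_
      split_ifs
      · exact one_mem _
      · exact zero_mem _
    · have h1 : ψ (MvPolynomial.X (.inr k)) = (κ (S k) * cK).trace := by
        rw [hcK, Matrix.mul_sum, Matrix.trace_sum]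
        simp [Matrix.trace_smul, hκtr, hSv]
      rw [h1]
      exact trace_mem _ (mul_entries_mem _ (map_entries_mem _ _) hcmem)
  have hPmem (p : Pl) : ψ p ∈ algebraicElements Φ.range := by
    induction p using MvPolynomial.induction_on with
    | C a => exact (ψ.commutes a) ▸ (algebraicElements Φ.range).algebraMap_mem a
    | add p q hp hq => rw [map_add]; exact add_mem hp hq
    | mul_X p i hp => rw [map_mul]; exact mul_mem hp (hXmem i)
  -- All the variables are algebraic over the entries of `A` and `B`, hence so is the whole function
  -- field.
  have halg : Algebra.IsAlgebraic Φ.range K := ⟨fun x => by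
    obtain ⟨p, q, -, rfl⟩ := IsFractionRing.div_surjective (A := Pl) x
    exact mem_algebraicElements.1 (div_mem (hPmem p) (hPmem q))⟩
  rw [trdeg_subalgebra_eq, trdeg_fractionRing_mvPolynomial, hσ]

/-! ### Jordan normal form of nilpotent matrices -/

/-- Corresponding fibres have equal cardinality, so bijections between them can be glued. This
serves to reorder Jordan blocks by size. -/
theorem exists_equiv_of_map_univ_eq {α β γ : Type*} [Fintype α] [Fintype β] [DecidableEq γ]
    (f : α → γ) (g : β → γ)
    (h : (Finset.univ : Finset α).val.map f = (Finset.univ : Finset β).val.map g) :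
    ∃ e : α ≃ β, ∀ a, g (e a) = f a := by
  have hc (c : γ) : Nonempty ({a // f a = c} ≃ {b // g b = c}) := by
    refine Fintype.card_eq.1 ?_
    have := congr_arg (Multiset.count c) h
    rw [Multiset.count_map, Multiset.count_map] at this
    rw [Fintype.card_subtype, Fintype.card_subtype]
    simpa [Finset.card_def, eq_comm] using this
  exact ⟨Equiv.ofFiberEquiv fun c => (hc c).some, fun a => Equiv.ofFiberEquiv_map _ a⟩

open Polynomial in
/-- The basis of `k[X] / (X ^ m)` in which multiplication by `X` is a Jordan block. -/
theorem exists_jordan_basis_quotient_X_pow (m : ℕ) :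
    ∃ c : Module.Basis (Fin m) ℂ (ℂ[X] ⧸ Submodule.span ℂ[X] {(X : ℂ[X]) ^ m}),
      ∀ x y, c.repr ((X : ℂ[X]) • c y) x = if (x : ℕ) + 1 = y then 1 else 0 := by
  let pb := AdjoinRoot.powerBasis' (monic_X_pow (R := ℂ) m)
  have hdim : pb.dim = m := by simp [pb]
  -- The power basis is reversed so that `X` lowers the index, putting the ones on the
  -- superdiagonal.
  let c : Module.Basis (Fin m) ℂ (AdjoinRoot ((X : ℂ[X]) ^ m)) :=
    pb.basis.reindex ((finCongr hdim).trans Fin.revPerm)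
  have hc (j : Fin m) : c j = AdjoinRoot.root _ ^ (m - 1 - (j : ℕ)) := by
    simp only [c, Module.Basis.reindex_apply, PowerBasis.basis_eq_pow]
    rw [AdjoinRoot.powerBasis'_gen]
    congr 1
    simp [Fin.val_rev]
    omega
  have hmul (j : Fin m) : AdjoinRoot.root _ * c j =
      if h : (j : ℕ) = 0 then 0 else c ⟨j - 1, by omega⟩ := by
    rw [hc, ← pow_succ']
    split_ifs with h
    · have h1 : m - 1 - (j : ℕ) + 1 = m := by omega
      rw [h1, ← AdjoinRoot.mk_X, ← map_pow, AdjoinRoot.mk_self]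
    · rw [hc]
      congr 1
      simp only
      omega
  refine ⟨c, fun x y => ?_⟩
  let mulX : AdjoinRoot ((X : ℂ[X]) ^ m) → AdjoinRoot ((X : ℂ[X]) ^ m) := fun v =>
    (HSMul.hSMul (X : ℂ[X]) (show ℂ[X] ⧸ Submodule.span ℂ[X] {(X : ℂ[X]) ^ m} from v) :
      ℂ[X] ⧸ Submodule.span ℂ[X] {(X : ℂ[X]) ^ m})
  have h1 (v) : mulX v = AdjoinRoot.root _ * v := by
    obtain ⟨p, rfl⟩ := AdjoinRoot.mk_surjective v
    rfl
  have h2 := congr_arg (fun v => c.repr v x) ((h1 _).trans (hmul y))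
  refine Eq.trans h2 ?_
  split_ifs with h3 h4 h4
  · omega
  · simp
  · rw [Module.Basis.repr_self, Finsupp.single_apply, if_pos]
    ext; simp; omega
  · rw [Module.Basis.repr_self, Finsupp.single_apply, if_neg]
    intro h5
    have := congr_arg Fin.val h5
    simp at this
    omega

theorem map_blocksFun_toComposition {n : ℕ} (l : n.Partition) :
    (Finset.univ : Finset (Fin l.toComposition.length)).val.map l.toComposition.blocksFun =
      l.parts := by
  rw [Fin.univ_val_map, Composition.ofFn_blocksFun]
  exact l.parts.sort_eq (· ≥ ·)

theorem jordanForm_apply {n : ℕ} (l : n.Partition) (x y) :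
    jordanForm l 0 (l.toComposition.blocksFinEquiv x) (l.toComposition.blocksFinEquiv y) =
      if x.1 = y.1 ∧ (x.2 : ℕ) + 1 = y.2 then 1 else 0 := by
  obtain ⟨i, a⟩ := x
  obtain ⟨j, b⟩ := y
  simp only [jordanForm, Matrix.reindex_apply, Matrix.submatrix_apply, Equiv.symm_apply_apply]
  by_cases hij : i = j
  · subst hij
    rw [Matrix.blockDiagonal'_apply_eq]
    simp only [jordanBlock, Matrix.of_apply, true_and]
    split_ifs with h1 h2
    · rw [h1] at h2; omega
    · rfl
    · rfl
    · rfl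
  · rw [Matrix.blockDiagonal'_apply_ne _ _ _ hij]
    simp [hij]

open Polynomial in
/-- A nilpotent endomorphism has a basis in which it is a direct sum of Jordan blocks. -/
theorem exists_jordan_basis {V : Type*} [AddCommGroup V] [Module ℂ V] [FiniteDimensional ℂ V]
    {f : V →ₗ[ℂ] V} (hf : IsNilpotent f) :
    ∃ (d : ℕ) (k : Fin d → ℕ) (b : Module.Basis (Σ i, Fin (k i)) ℂ V),
      ∀ x y, b.repr (f (b y)) x = if x.1 = y.1 ∧ (x.2 : ℕ) + 1 = y.2 then 1 else 0 := by
  obtain ⟨N, hN⟩ := hf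
  -- With `X` acting as `f`, the space is an `X`-power torsion `ℂ[X]`-module, and the structure
  -- theorem splits it into quotients by powers of `X`.
  have htors : Module.IsTorsion' (Module.AEval' f) (Submonoid.powers (X : ℂ[X])) := by
    intro x
    refine ⟨⟨X ^ N, N, rfl⟩, ?_⟩
    obtain ⟨v, rfl⟩ := (Module.AEval'.of f).surjective x
    change (X ^ N : ℂ[X]) • (Module.AEval'.of f v) = _
    rw [Module.AEval'.X_pow_smul_of, hN]
    simp
  have : Module.Finite ℂ[X] (Module.AEval' f) := inferInstance
  obtain ⟨d, k, ⟨e⟩⟩ := Module.torsion_by_prime_power_decomposition (p := (X : ℂ[X]))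
    (Polynomial.irreducible_X) htors
  choose c hc using fun i => exists_jordan_basis_quotient_X_pow (k i)
  let b0 : Module.Basis (Σ i, Fin (k i)) ℂ
    (DirectSum (Fin d) fun i => ℂ[X] ⧸ Submodule.span ℂ[X] {(X : ℂ[X]) ^ k i}) :=
    DFinsupp.basis c
  let E := (Module.AEval'.of f).trans (e.restrictScalars ℂ)
  refine ⟨d, k, b0.map E.symm, fun x y => ?_⟩
  have hE (v : V) : E (f v) = (X : ℂ[X]) • E v := by
    change e (Module.AEval'.of f (f v)) = (X : ℂ[X]) • e (Module.AEval'.of f v)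
    rw [← map_smul, Module.AEval'.X_smul_of]
  rw [Module.Basis.map_repr, LinearEquiv.symm_symm, LinearEquiv.trans_apply, hE,
    Module.Basis.map_apply, LinearEquiv.apply_symm_apply]
  have hrepr (w) (x : Σ i, Fin (k i)) : b0.repr w x = (c x.1).repr (w x.1) x.2 := rfl
  rw [hrepr]
  obtain ⟨i, a⟩ := x
  obtain ⟨j, b⟩ := y
  have hsmul (w : DirectSum (Fin d) fun i => ℂ[X] ⧸ Submodule.span ℂ[X] {(X : ℂ[X]) ^ k i}) :
      ((X : ℂ[X]) • w) i = (X : ℂ[X]) • w i := rfl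
  rw [hsmul]
  have hcomp (a' : Fin (k i)) : (c i).repr (b0 ⟨j, b⟩ i) a' =
      if (⟨j, b⟩ : Σ i, Fin (k i)) = ⟨i, a'⟩ then 1 else 0 := by
    rw [← hrepr (b0 ⟨j, b⟩) ⟨i, a'⟩, Module.Basis.repr_self, Finsupp.single_apply]
  by_cases hij : i = j
  · subst hij
    have h1 : b0 ⟨i, b⟩ i = c i b := by
      refine (c i).repr.injective (Finsupp.ext fun a' => ?_)
      rw [hcomp, Module.Basis.repr_self, Finsupp.single_apply]
      simp
    rw [h1, hc]
    simp
  · have h1 : b0 ⟨j, b⟩ i = 0 := by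
      refine (c i).repr.injective (Finsupp.ext fun a' => ?_)
      rw [hcomp, if_neg, map_zero, Finsupp.zero_apply]
      exact fun h => hij (congr_arg Sigma.fst h).symm
    rw [h1]
    simp [hij]

/-- **Jordan normal form** of a nilpotent matrix. -/
theorem exists_eq_conj_jordanForm {n : ℕ} {A : Matrix (Fin n) (Fin n) ℂ} (hA : IsNilpotent A) :
    ∃ (l : n.Partition) (g : GL (Fin n) ℂ), A = (g : Matrix (Fin n) (Fin n) ℂ) *
      jordanForm l 0 * ((g⁻¹ : GL (Fin n) ℂ) : Matrix (Fin n) (Fin n) ℂ) := by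
  obtain ⟨d, k, b, hb⟩ := exists_jordan_basis (f := Matrix.toLin' A)
    (hA.map (Matrix.toLinAlgEquiv' : Matrix (Fin n) (Fin n) ℂ ≃ₐ[ℂ] _))
  have hsum : ∑ i, k i = n := by
    have h1 := Module.finrank_eq_card_basis b
    simp only [Module.finrank_fin_fun, Fintype.card_sigma, Fintype.card_fin] at h1
    exact h1.symm
  let l : n.Partition := Nat.Partition.ofSums n ((Finset.univ : Finset (Fin d)).val.map k) hsum
  -- The decomposition may contain zero exponents; they carry no basis vectors, and
  -- `Nat.Partition.ofSums` drops them.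
  let I := {i : Fin d // k i ≠ 0}
  let c := l.toComposition
  have hblocks : (Finset.univ : Finset I).val.map (fun i : I => k i.1) =
      (Finset.univ : Finset (Fin c.length)).val.map c.blocksFun := by
    rw [map_blocksFun_toComposition]
    have h2 : l.parts = ((Finset.univ : Finset (Fin d)).val.map k).filter (· ≠ 0) := rfl
    have h3 : (Finset.univ : Finset I).val.map (fun i : I => k i.1) =
        ((Finset.univ : Finset I).val.map Subtype.val).map k := by
      rw [Multiset.map_map]; rfl
    rw [h2, h3, Multiset.filter_map]
    congr 1
    have h4 := congr_arg Finset.val (Finset.subtype_map (fun i : Fin d => k i ≠ 0)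
      (s := Finset.univ))
    rw [Finset.map_val, Finset.subtype_univ] at h4
    exact h4
  obtain ⟨e, he⟩ := exists_equiv_of_map_univ_eq _ _ hblocks
  let ε : (Σ i, Fin (k i)) ≃ (Σ i, Fin (c.blocksFun i)) :=
    { toFun := fun x => ⟨e ⟨x.1, by have := x.2.2; omega⟩, finCongr (he _).symm x.2⟩
      invFun := fun y => ⟨(e.symm y.1).1, finCongr (by rw [← he, e.apply_symm_apply]) y.2⟩
      left_inv := fun x => by
        refine Sigma.ext (by simp) ?_
        rw [Fin.heq_ext_iff (by simp)]
        simp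
      right_inv := fun y => by
        refine Sigma.ext (by simp) ?_
        rw [Fin.heq_ext_iff (by simp)]
        simp }
  have hε2 (x) : ((ε x).2 : ℕ) = x.2 := rfl
  have hε1 (x y) : (ε x).1 = (ε y).1 ↔ x.1 = y.1 := by
    exact e.injective.eq_iff.trans Subtype.ext_iff
  let b' := b.reindex (ε.trans c.blocksFinEquiv)
  have hmat : LinearMap.toMatrix b' b' (Matrix.toLin' A) = jordanForm l 0 := by
    ext i j
    obtain ⟨x, rfl⟩ := (ε.trans c.blocksFinEquiv).surjective i
    obtain ⟨y, rfl⟩ := (ε.trans c.blocksFinEquiv).surjective j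
    rw [LinearMap.toMatrix_apply]
    simp only [b', Module.Basis.reindex_apply, Equiv.symm_apply_apply,
      Module.Basis.repr_reindex_apply]
    rw [hb, Equiv.trans_apply, Equiv.trans_apply, jordanForm_apply]
    simp only [hε1, hε2]
  let s := Pi.basisFun ℂ (Fin n)
  let g : GL (Fin n) ℂ := ⟨s.toMatrix b', b'.toMatrix s, s.toMatrix_mul_toMatrix_flip b',
    b'.toMatrix_mul_toMatrix_flip s⟩
  refine ⟨l, g, ?_⟩
  rw [← hmat]
  change A = s.toMatrix b' * _ * b'.toMatrix s
  rw [basis_toMatrix_mul_linearMap_toMatrix_mul_basis_toMatrix]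
  exact (LinearMap.toMatrix'_toLin' A).symm

theorem jordanForm_pow_apply {n : ℕ} (l : n.Partition) (k : ℕ) (x y) :
    (jordanForm l 0 ^ k) (l.toComposition.blocksFinEquiv x) (l.toComposition.blocksFinEquiv y) =
      if x.1 = y.1 ∧ (x.2 : ℕ) + k = y.2 then 1 else 0 := by
  induction k generalizing y with
  | zero =>
    rw [pow_zero, Matrix.one_apply]
    simp only [EmbeddingLike.apply_eq_iff_eq, add_zero]
    congr 1
    refine propext ⟨fun h => by subst h; exact ⟨rfl, rfl⟩, fun ⟨h1, h2⟩ => Sigma.ext h1 ?_⟩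
    rwa [Fin.heq_ext_iff (by rw [h1])]
  | succ k ih =>
    rw [pow_succ, Matrix.mul_apply, ← l.toComposition.blocksFinEquiv.sum_comp]
    simp only [ih, jordanForm_apply]
    obtain ⟨i, a⟩ := x
    obtain ⟨j, b⟩ := y
    by_cases hb : (b : ℕ) = 0
    · rw [Finset.sum_eq_zero fun z _ => ?_, if_neg]
      · simp only; omega
      · rw [if_neg (c := _ ∧ _ = (b : ℕ)), mul_zero]
        omega
    · rw [Finset.sum_eq_single (⟨j, ⟨b - 1, by omega⟩⟩ : Σ i, Fin (l.toComposition.blocksFun i))]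
      · have h1 : (b : ℕ) - 1 + 1 = b := by omega
        simp only [h1, true_and, if_true, mul_one]
        congr 1
        refine propext (and_congr_right fun _ => ?_)
        omega
      · intro z _ hz
        rw [if_neg (c := _ ∧ _ = (b : ℕ)), mul_zero]
        rintro ⟨h1, h2⟩
        apply hz
        refine Sigma.ext h1 ?_
        rw [Fin.heq_ext_iff (by rw [h1])]
        simp only at h2 ⊢
        omega
      · simp

theorem jordanForm_pow_self {n : ℕ} (l : n.Partition) : jordanForm l 0 ^ n = 0 := by
  ext i j
  obtain ⟨x, rfl⟩ := l.toComposition.blocksFinEquiv.surjective i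
  obtain ⟨y, rfl⟩ := l.toComposition.blocksFinEquiv.surjective j
  rw [jordanForm_pow_apply, if_neg, Matrix.zero_apply]
  have := y.2.2
  have := l.toComposition.blocksFun_le y.1
  omega

theorem conj_pow_eq {n : ℕ} (g : GL (Fin n) ℂ) (M : Matrix (Fin n) (Fin n) ℂ) (k : ℕ) :
    ((g : Matrix (Fin n) (Fin n) ℂ) * M * ((g⁻¹ : GL (Fin n) ℂ) : Matrix (Fin n) (Fin n) ℂ)) ^ k =
      (g : Matrix (Fin n) (Fin n) ℂ) * M ^ k *
        ((g⁻¹ : GL (Fin n) ℂ) : Matrix (Fin n) (Fin n) ℂ) :=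
  Units.conj_pow g M k

/-- The uniform exponent `n` makes nilpotency a polynomial condition on the entries. -/
theorem isNilpotent_iff_pow_eq_zero {n : ℕ} (A : Matrix (Fin n) (Fin n) ℂ) :
    IsNilpotent A ↔ A ^ n = 0 := by
  refine ⟨fun h => ?_, fun h => ⟨n, h⟩⟩
  obtain ⟨l, g, rfl⟩ := exists_eq_conj_jordanForm h
  rw [conj_pow_eq, jordanForm_pow_self]
  simp

/-- An invertible matrix anti-commuting with the nilpotent Jordan form. -/
theorem exists_antiCommute_jordanForm {n : ℕ} (l : n.Partition) :
    ∃ D : Matrix (Fin n) (Fin n) ℂ, D.det ≠ 0 ∧ D * jordanForm l 0 = -(jordanForm l 0 * D) := by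
  -- The sign alternates along each block, and `J` only links neighbouring positions of one block.
  refine ⟨Matrix.diagonal fun i => (-1) ^ ((l.toComposition.blocksFinEquiv.symm i).2 : ℕ), ?_, ?_⟩
  · rw [Matrix.det_diagonal]
    exact Finset.prod_ne_zero_iff.2 fun i _ => pow_ne_zero _ (by norm_num)
  · ext i j
    obtain ⟨x, rfl⟩ := l.toComposition.blocksFinEquiv.surjective i
    obtain ⟨y, rfl⟩ := l.toComposition.blocksFinEquiv.surjective j
    rw [Matrix.diagonal_mul, Matrix.neg_apply, Matrix.mul_diagonal, jordanForm_apply,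
      Equiv.symm_apply_apply, Equiv.symm_apply_apply]
    split_ifs with h
    · rw [← h.2, pow_succ]
      ring
    · simp

/-! ### Ranks of powers distinguish partitions -/

theorem sum_parts_map {n : ℕ} (l : n.Partition) (f : ℕ → ℕ) :
    ∑ i, f (l.toComposition.blocksFun i) = (l.parts.map f).sum := by
  rw [← map_blocksFun_toComposition, Multiset.map_map]
  rfl

/-- The rank of the `k`-th power of a Jordan form with block sizes `λᵢ` is at most
`∑ (λᵢ - k)⁺`. -/
theorem rank_jordanForm_pow_le {n : ℕ} (l : n.Partition) (k : ℕ) :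
    (jordanForm l 0 ^ k).rank ≤ (l.parts.map (· - k)).sum := by
  -- The positions at least `k` steps before the end of their block index the only rows of `J ^ k`
  -- that can be nonzero, so `J ^ k` factors through them.
  let T := Σ i, Fin (l.toComposition.blocksFun i - k)
  let α : T → Σ i, Fin (l.toComposition.blocksFun i) :=
    fun t => ⟨t.1, ⟨t.2, by have := t.2.2; omega⟩⟩
  have hα : Function.Injective α := by
    rintro ⟨i, a⟩ ⟨j, b⟩ h
    obtain rfl : i = j := congr_arg Sigma.fst h
    have h1 : (a : ℕ) = b := by simpa [α] using h
    rw [Fin.ext h1]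
  have hcard : Fintype.card T = (l.parts.map (· - k)).sum := by
    rw [← sum_parts_map]
    simp [T]
  let P : Matrix (Fin n) T ℂ := Matrix.of fun i t =>
    if l.toComposition.blocksFinEquiv (α t) = i then 1 else 0
  let R : Matrix T (Fin n) ℂ := Matrix.of fun t j =>
    (jordanForm l 0 ^ k) (l.toComposition.blocksFinEquiv (α t)) j
  have hPR : jordanForm l 0 ^ k = P * R := by
    ext i j
    obtain ⟨x, rfl⟩ := l.toComposition.blocksFinEquiv.surjective i
    obtain ⟨y, rfl⟩ := l.toComposition.blocksFinEquiv.surjective j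
    rw [Matrix.mul_apply]
    simp only [P, R, Matrix.of_apply, EmbeddingLike.apply_eq_iff_eq]
    by_cases hx : (x.2 : ℕ) < l.toComposition.blocksFun x.1 - k
    · have hαx : α ⟨x.1, ⟨x.2, hx⟩⟩ = x := rfl
      rw [Finset.sum_eq_single (⟨x.1, ⟨x.2, hx⟩⟩ : T), hαx]
      · simp
      · intro t _ ht
        rw [if_neg, zero_mul]
        exact fun h => ht (hα h)
      · simp
    · rw [jordanForm_pow_apply, if_neg, Finset.sum_eq_zero]
      · intro t _
        rw [if_neg, zero_mul]
        rintro rfl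
        exact hx t.2.2
      · rintro ⟨h1, h2⟩
        have h3 := y.2.2
        have h4 := congr_arg l.toComposition.blocksFun h1
        omega
  rw [hPR, ← hcard]
  exact (Matrix.rank_mul_le_left P R).trans (Matrix.rank_le_card_width P)

theorem det_submatrix_eq_zero_of_rank_lt {m T : Type*} [Fintype m] [Fintype T]
    [DecidableEq T] {A : Matrix m m ℂ} (h : A.rank < Fintype.card T) (α β : T → m) :
    (A.submatrix α β).det = 0 := by
  by_contra hne
  have h1 : (A.submatrix α β).rank = Fintype.card T :=
    Matrix.rank_of_isUnit _ ((Matrix.isUnit_iff_isUnit_det _).2 (isUnit_iff_ne_zero.2 hne))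
  have h2 := A.rank_submatrix_le α β
  omega

/-- Ranks of powers of the first matrix do not increase in the Zariski closure. -/
theorem sum_parts_tsub_le_of_mem_closure {n : ℕ} {l m : n.Partition}
    (h : (⟨jordanForm l 0, 0⟩ : MatPair n) ∈ closure (conjOrbits (jordanForm m 0))) (k : ℕ) :
    (l.parts.map (· - k)).sum ≤ (m.parts.map (· - k)).sum := by
  by_contra! hlt
  let T := Σ i, Fin (l.toComposition.blocksFun i - k)
  have hcard : Fintype.card T = (l.parts.map (· - k)).sum := by
    rw [← sum_parts_map]
    simp [T]
  let α : T → Fin n := fun t =>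
    l.toComposition.blocksFinEquiv ⟨t.1, ⟨t.2, by have := t.2.2; omega⟩⟩
  let β : T → Fin n := fun t =>
    l.toComposition.blocksFinEquiv ⟨t.1, ⟨t.2 + k, by have := t.2.2; omega⟩⟩
  let M : Matrix (Fin n) (Fin n) (MatPair.EntryPoly n) :=
    Matrix.of fun i j => MvPolynomial.X (.inl (i, j))
  let f : MatPair.EntryPoly n := ((M ^ k).submatrix α β).det
  have hf (P : MatPair n) : MvPolynomial.eval P.coords f = ((P.A ^ k).submatrix α β).det := by
    have hM : (MvPolynomial.eval P.coords).mapMatrix M = P.A := by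
      ext i j
      simp [M, MatPair.coords]
    have hpow := map_pow (MvPolynomial.eval P.coords).mapMatrix M k
    rw [RingHom.map_det, ← hM, ← hpow]
    rfl
  have hmem : f ∈ MatPair.vanishingIdeal (conjOrbits (jordanForm m 0)) := by
    rw [MatPair.mem_vanishingIdeal]
    rintro _ ⟨g, B, -, rfl⟩
    rw [hf]
    apply det_submatrix_eq_zero_of_rank_lt
    rw [hcard]
    refine lt_of_le_of_lt ?_ hlt
    refine le_trans ?_ (rank_jordanForm_pow_le m k)
    change ((_ * _ * _ : Matrix (Fin n) (Fin n) ℂ) ^ k).rank ≤ _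
    rw [conj_pow_eq]
    exact (Matrix.rank_mul_le_left _ _).trans (Matrix.rank_mul_le_right _ _)
  rw [MatPair.closure_eq_zeroLocus] at h
  have h1 := h f hmem
  rw [hf] at h1
  have h2 : (jordanForm l 0 ^ k).submatrix α β = 1 := by
    ext s t
    simp only [Matrix.submatrix_apply, α, β]
    rw [jordanForm_pow_apply, Matrix.one_apply]
    congr 1
    refine propext ⟨fun ⟨h1, h2⟩ => Sigma.ext h1 ?_, fun h => by subst h; exact ⟨rfl, rfl⟩⟩
    simp only at h1 h2
    rw [Fin.heq_ext_iff (by rw [h1])]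
    omega
  rw [h2, det_one] at h1
  exact one_ne_zero h1

/-- The second difference of `k ↦ ∑ (λᵢ - k)⁺`, centred at `k + 1`, is the number of parts equal to
`k + 1`. -/
theorem parts_eq_of_sum_tsub_eq {n : ℕ} {l m : n.Partition}
    (h : ∀ k, (l.parts.map (· - k)).sum = (m.parts.map (· - k)).sum) : l = m := by
  have key (s : Multiset ℕ) (k : ℕ) : (s.map (· - k)).sum + (s.map (· - (k + 2))).sum =
      2 * (s.map (· - (k + 1))).sum + s.count (k + 1) := by
    induction s using Multiset.induction_on with
    | empty => simp
    | cons a s ih =>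
      simp only [Multiset.map_cons, Multiset.sum_cons, Multiset.count_cons]
      split_ifs <;> omega
  refine Nat.Partition.ext (Multiset.ext.2 fun a => ?_)
  rcases a with _ | a
  · rw [Multiset.count_eq_zero_of_notMem fun h => (l.parts_pos h).false,
      Multiset.count_eq_zero_of_notMem fun h => (m.parts_pos h).false]
  · have h1 := key l.parts a
    have h2 := key m.parts a
    rw [h, h, h] at h1
    omega

end

/-! ### The irreducible components -/

theorem nilComponent_eq_closure {n : ℕ} (l : n.Partition) :
    nilComponent l = closure (conjOrbits (jordanForm l 0)) := by
  have hnil : IsNilpotent (jordanForm l 0) := ⟨n, jordanForm_pow_self l⟩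
  simp only [nilComponent, conjOrbits, semiNilpotentVariety, Set.mem_ofPred_eq, hnil, and_true]

theorem isClosed_semiNilpotentVariety (n : ℕ) : IsClosed (semiNilpotentVariety n) := by
  let M : Matrix (Fin n) (Fin n) (MatPair.EntryPoly n) :=
    Matrix.of fun i j => MvPolynomial.X (.inl (i, j))
  let N : Matrix (Fin n) (Fin n) (MatPair.EntryPoly n) :=
    Matrix.of fun i j => MvPolynomial.X (.inr (i, j))
  rw [MatPair.isClosed_iff]
  refine ⟨Set.range (fun ij : Fin n × Fin n => (M * N + N * M) ij.1 ij.2) ∪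
    Set.range (fun ij : Fin n × Fin n => (M ^ n) ij.1 ij.2), ?_⟩
  ext P
  have hM : (MvPolynomial.eval P.coords).mapMatrix M = P.A := by
    ext i j
    simp [M, MatPair.coords]
  have hN : (MvPolynomial.eval P.coords).mapMatrix N = P.B := by
    ext i j
    simp [N, MatPair.coords]
  have h1 : (MvPolynomial.eval P.coords).mapMatrix (M * N + N * M) = P.A * P.B + P.B * P.A := by
    rw [map_add, map_mul, map_mul, hM, hN]
  have h2 : (MvPolynomial.eval P.coords).mapMatrix (M ^ n) = P.A ^ n := by
    rw [map_pow, hM]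
  simp only [semiNilpotentVariety, Set.mem_ofPred_eq, isNilpotent_iff_pow_eq_zero, ← h1, ← h2,
    MatPair.zeroLocus]
  constructor
  · rintro ⟨h3, h4⟩ f (⟨⟨i, j⟩, rfl⟩ | ⟨⟨i, j⟩, rfl⟩)
    · exact congr_fun (congr_fun h3 i) j
    · exact congr_fun (congr_fun h4 i) j
  · intro h
    exact ⟨Matrix.ext fun i j => h _ (.inl ⟨(i, j), rfl⟩),
      Matrix.ext fun i j => h _ (.inr ⟨(i, j), rfl⟩)⟩

theorem isIrreducible_nilComponent {n : ℕ} (l : n.Partition) : IsIrreducible (nilComponent l) := by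
  obtain ⟨D, hD, hDJ⟩ := exists_antiCommute_jordanForm l
  rw [nilComponent_eq_closure]
  exact (MatPair.isIrreducible_of_isPrime (isPrime_and_ringKrullDim_conjOrbits hD hDJ).1).closure

theorem topologicalKrullDim_nilComponent {n : ℕ} (l : n.Partition) :
    topologicalKrullDim (nilComponent l) = ((n ^ 2 : ℕ) : WithBot ℕ∞) := by
  obtain ⟨D, hD, hDJ⟩ := exists_antiCommute_jordanForm l
  rw [nilComponent_eq_closure, MatPair.topologicalKrullDim_closure]
  exact (isPrime_and_ringKrullDim_conjOrbits hD hDJ).2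

theorem nilComponent_subset {n : ℕ} (l : n.Partition) :
    nilComponent l ⊆ semiNilpotentVariety n := by
  refine closure_minimal ?_ (isClosed_semiNilpotentVariety n)
  rintro _ ⟨g, B, ⟨hB, N, hN⟩, rfl⟩
  refine ⟨?_, N, ?_⟩
  · have h (X Y : Matrix (Fin n) (Fin n) ℂ) :
        (g : Matrix (Fin n) (Fin n) ℂ) * X * ((g⁻¹ : GL (Fin n) ℂ) : Matrix (Fin n) (Fin n) ℂ) *
        (g * Y * ((g⁻¹ : GL (Fin n) ℂ) : Matrix (Fin n) (Fin n) ℂ)) =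
        g * (X * Y) * ((g⁻¹ : GL (Fin n) ℂ) : Matrix (Fin n) (Fin n) ℂ) := by
      simp only [mul_assoc, Units.inv_mul_cancel_left]
    simp only [MatPair.conj]
    rw [h, h, ← add_mul, ← mul_add, hB]
    simp
  · simp only [MatPair.conj]
    rw [conj_pow_eq, hN]
    simp

theorem semiNilpotentVariety_subset_iUnion (n : ℕ) :
    semiNilpotentVariety n ⊆ ⋃ l : n.Partition, nilComponent l := by
  rintro ⟨A, B⟩ ⟨hAB, hA⟩
  obtain ⟨l, g, rfl⟩ := exists_eq_conj_jordanForm hA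
  rw [Set.mem_iUnion]
  refine ⟨l, ?_⟩
  rw [nilComponent_eq_closure]
  apply subset_closure
  simp only at hAB
  refine ⟨g, ((g⁻¹ : GL (Fin n) ℂ) : Matrix (Fin n) (Fin n) ℂ) * B * g, ?_, ?_⟩
  · have h := congr_arg (fun M => ((g⁻¹ : GL (Fin n) ℂ) : Matrix (Fin n) (Fin n) ℂ) * M * g) hAB
    simpa only [mul_add, add_mul, mul_assoc, Units.inv_mul_cancel_left, Units.inv_mul, mul_one,
      mul_zero, zero_mul] using h
  · ext1
    · rfl
    · simp only [MatPair.conj, mul_assoc, Units.mul_inv_cancel_left, Units.mul_inv, mul_one]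

theorem nilComponent_injective (n : ℕ) :
    Function.Injective (fun l : n.Partition => nilComponent l) := by
  have hmem (l : n.Partition) : (⟨jordanForm l 0, 0⟩ : MatPair n) ∈ nilComponent l := by
    rw [nilComponent_eq_closure]
    exact subset_closure ⟨1, 0, by simp, by ext1 <;> simp [MatPair.conj]⟩
  intro l m h
  simp only at h
  refine parts_eq_of_sum_tsub_eq fun k => le_antisymm ?_ ?_
  · apply sum_parts_tsub_le_of_mem_closure
    rw [← nilComponent_eq_closure, ← h]
    exact hmem l
  · apply sum_parts_tsub_le_of_mem_closure
    rw [← nilComponent_eq_closure, h]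
    exact hmem m

/-- A proper inclusion of irreducible closed sets strictly lowers the dimension, but both have
dimension `n²`. -/
theorem nilComponent_eq_of_subset {n : ℕ} {l m : n.Partition}
    (h : nilComponent l ⊆ nilComponent m) : nilComponent l = nilComponent m := by
  obtain ⟨D, hD, hDJ⟩ := exists_antiCommute_jordanForm l
  obtain ⟨E, hE, hEJ⟩ := exists_antiCommute_jordanForm m
  obtain ⟨-, hldim⟩ := isPrime_and_ringKrullDim_conjOrbits hD hDJ
  obtain ⟨hmprime, hmdim⟩ := isPrime_and_ringKrullDim_conjOrbits hE hEJ
  rw [nilComponent_eq_closure, nilComponent_eq_closure] at h ⊢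
  have hle : MatPair.vanishingIdeal (conjOrbits (jordanForm m 0)) ≤
      MatPair.vanishingIdeal (conjOrbits (jordanForm l 0)) := by
    rw [← MatPair.vanishingIdeal_closure, ← MatPair.vanishingIdeal_closure (conjOrbits _)]
    exact fun f hf => MatPair.mem_vanishingIdeal.2 fun P hP =>
      MatPair.mem_vanishingIdeal.1 hf P (h hP)
  rw [MatPair.closure_eq_zeroLocus, MatPair.closure_eq_zeroLocus]
  rcases hle.eq_or_lt with heq | hlt
  · rw [heq]
  exfalso
  obtain ⟨f, hfl, hfm⟩ := SetLike.exists_of_lt hlt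
  -- `f` is a nonzero element of a domain that dies in the further quotient, giving `n² + 1 ≤ n²`.
  have hdim := ringKrullDim_succ_le_of_surjective (Ideal.Quotient.factor hle)
    (Ideal.Quotient.factor_surjective hle) (r := Ideal.Quotient.mk _ f)
    (mem_nonZeroDivisors_of_ne_zero (mt Ideal.Quotient.eq_zero_iff_mem.1 hfm))
    (by rw [Ideal.Quotient.factor_mk]; exact Ideal.Quotient.eq_zero_iff_mem.2 hfl)
  rw [hldim, hmdim] at hdim
  norm_cast at hdim
  omega

/-- An irreducible set covered by finitely many closed sets lies in one of them, and there are
finitely many partitions of `n`. -/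
theorem exists_subset_nilComponent {n : ℕ} {S : Set (MatPair n)} (hS : IsIrreducible S)
    (hSn : S ⊆ semiNilpotentVariety n) : ∃ l : n.Partition, S ⊆ nilComponent l := by
  classical
  obtain ⟨Z, hZ, hSZ⟩ := isIrreducible_iff_sUnion_isClosed.1 hS
    (Finset.univ.image fun l : n.Partition => nilComponent l)
    (by
      intro Z hZ
      obtain ⟨l, -, rfl⟩ := Finset.mem_image.1 hZ
      exact isClosed_closure)
    (by
      refine hSn.trans ((semiNilpotentVariety_subset_iUnion n).trans ?_)
      exact Set.iUnion_subset fun l => Set.subset_sUnion_of_mem (by simp))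
  obtain ⟨l, -, rfl⟩ := Finset.mem_image.1 hZ
  exact ⟨l, hSZ⟩

theorem image_irreducibleComponents_semiNilpotentVariety (n : ℕ) :
    (fun S : Set (semiNilpotentVariety n) => (Subtype.val '' S : Set (MatPair n))) ''
        irreducibleComponents (semiNilpotentVariety n) =
      Set.range (fun l : n.Partition => nilComponent l) := by
  have hval {S : Set (semiNilpotentVariety n)} (hS : IsIrreducible S) :
      ∃ l : n.Partition, Subtype.val '' S ⊆ nilComponent l :=
    exists_subset_nilComponent (hS.image _ continuous_subtype_val.continuousOn)
      (Subtype.coe_image_subset _ _)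
  have hirr (l : n.Partition) :
      IsIrreducible (Subtype.val ⁻¹' nilComponent l : Set (semiNilpotentVariety n)) :=
    (isIrreducible_nilComponent l).preimage_val_of_isClosed (isClosed_semiNilpotentVariety n)
      (nilComponent_subset l)
  have himg (l : n.Partition) :
      Subtype.val '' (Subtype.val ⁻¹' nilComponent l : Set (semiNilpotentVariety n)) =
        nilComponent l := by
    rw [Subtype.image_preimage_coe, Set.inter_eq_right]
    exact nilComponent_subset l
  ext Z
  constructor
  · rintro ⟨S, hS, rfl⟩
    obtain ⟨l, hl⟩ := hval hS.1
    refine ⟨l, subset_antisymm ?_ hl⟩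
    have h1 := hS.2 (hirr l) (Set.image_subset_iff.1 hl)
    have h2 := Set.image_mono (f := Subtype.val) h1
    rwa [himg] at h2
  · rintro ⟨l, rfl⟩
    refine ⟨_, ⟨hirr l, fun T hT hlT => ?_⟩, himg l⟩
    obtain ⟨m, hm⟩ := hval hT
    have h1 := Set.image_mono (f := Subtype.val) hlT
    rw [himg] at h1
    have h2 := nilComponent_eq_of_subset (h1.trans hm)
    rw [← h2] at hm
    exact Set.image_subset_iff.1 hm

theorem theorem5p3 (n : ℕ) :
    IsClosed (semiNilpotentVariety n) ∧
    (fun S : Set (semiNilpotentVariety n) => (Subtype.val '' S : Set (MatPair n))) ''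
        irreducibleComponents (semiNilpotentVariety n) =
      Set.range (fun l : n.Partition => nilComponent l) ∧
    Function.Injective (fun l : n.Partition => nilComponent l) ∧
    ∀ l : n.Partition,
      topologicalKrullDim (nilComponent l) = ((n ^ 2 : ℕ) : WithBot ℕ∞) :=
  ⟨isClosed_semiNilpotentVariety n, image_irreducibleComponents_semiNilpotentVariety n,
    nilComponent_injective n, topologicalKrullDim_nilComponent⟩
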